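/- For $e\ge 0$ let $\mathbb{F}_e=\mathbb{P}(\mathcal O_{\mathbb P^1}\oplus\mathcal O_{\mathbb P^1}(-e))$ be the complex Hirzebruch surface, with homogeneous coordinate ring $\mathbb{C}[x_0,x_1,y_0,y_1]$ graded by $\deg x_0=\deg x_1=(1,0)$, $\deg y_0=(0,1)$, $\deg y_1=(-e,1)$. A curve of type $(a,b)$ on $\mathbb{F}_e$ is the zero set of an irreducible polynomial that is homogeneous of bidegree $(a,b)$. Such a curve is rational if its geometric genus is $0$. A cusp of a curve is a singular point at which the germ of the curve is irreducible, and a curve is cuspidal if all its singular points are cusps. The multiplicity sequence of a cusp $p$ is $[m,m_1,\ldots,m_{t-1}]$, where $t$ is the number of blow-ups in the local minimal embedded resolution of the cusp (to a simple normal crossing divisor), $m$ is the multiplicity of the curve at $p$, and $m_i$ is the multiplicity of its strict transform at the $i$-th infinitely near point; the ones at the end of the sequence are omitted from the notation. The collection of the multiplicity sequences of all cusps is the cuspidal configuration of the curve. **Theorem.** On $\mathbb{F}_2$ there exists a rational cuspidal curve of type $(0,3)$ with exactly four cusps and cuspidal configuration $[2],[2],[2],[2]$. -/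

import Mathlib

noncomputable section

namespace Hirzebruch

open MvPolynomial

/-! ## Hirzebruch surfaces in homogeneous (Cox) coordinates -/

/-- The four homogeneous coordinates: `Sum.inl i` is `x_i` and `Sum.inr j` is `y_j`. -/
abbrev Var : Type := Fin 2 ⊕ Fin 2

/-- The bidegrees: `deg x₀ = deg x₁ = (1,0)`, `deg y₀ = (0,1)`, `deg y₁ = (-e,1)`. -/
def weight (e : ℕ) : Var → ℤ × ℤ :=
  Sum.elim (fun _ => (1, 0)) ![(0, 1), (-(e : ℤ), 1)]

/-- The coordinate ring `ℂ[x₀,x₁,y₀,y₁]` of the Hirzebruch surface. -/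
abbrev CoxRing : Type := MvPolynomial Var ℂ

/-- Homogeneous coordinates: quadruples with `(x₀,x₁) ≠ (0,0)` and `(y₀,y₁) ≠ (0,0)`. -/
abbrev Coords : Type :=
  {z : Var → ℂ // (∃ i : Fin 2, z (Sum.inl i) ≠ 0) ∧ (∃ j : Fin 2, z (Sum.inr j) ≠ 0)}

/-- Two quadruples are equivalent if they are in one orbit of the torus `(ℂˣ)²`, which acts by
`(s,t) · (x₀,x₁,y₀,y₁) = (s x₀, s x₁, t y₀, s⁻ᵉ t y₁)`. -/
def coordsSetoid (e : ℕ) : Setoid Coords where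
  r z z' := ∃ s t : ℂˣ, ∀ v : Var,
    z'.1 v = ((s ^ (weight e v).1 * t ^ (weight e v).2 : ℂˣ) : ℂ) * z.1 v
  iseqv :=
    { refl := fun z => ⟨1, 1, fun v => by simp⟩
      symm := by
        rintro z z' ⟨s, t, h⟩
        refine ⟨s⁻¹, t⁻¹, fun v => ?_⟩
        rw [h v, ← mul_assoc, ← Units.val_mul, inv_zpow, inv_zpow, ← mul_inv, inv_mul_cancel]
        simp
      trans := by
        rintro z z' z'' ⟨s, t, h⟩ ⟨s', t', h'⟩
        refine ⟨s' * s, t' * t, fun v => ?_⟩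
        rw [h' v, h v, ← mul_assoc, ← Units.val_mul, mul_zpow, mul_zpow, mul_mul_mul_comm] }

/-- The (closed points of the) Hirzebruch surface `𝔽_e` over `ℂ`, as the toric quotient. -/
def Surface (e : ℕ) : Type := Quotient (coordsSetoid e)

/-- The point of `𝔽_e` with given homogeneous coordinates. -/
def Surface.mk (e : ℕ) (z : Coords) : Surface e := Quotient.mk (coordsSetoid e) z

/-- The homogeneous coordinates `x_i = 1`, `y_j = 1`, and `r`, `s` for the other `x` and
the other `y`. -/
def chartCoords (i j : Fin 2) (r s : ℂ) : Coords :=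
  ⟨Sum.elim (fun k => if k = i then 1 else r) (fun k => if k = j then 1 else s),
    ⟨i, by simp⟩, ⟨j, by simp⟩⟩

/-- The affine chart `ℂ² ≅ {x_i ≠ 0, y_j ≠ 0} ⊆ 𝔽_e`. -/
def chartPoint (e : ℕ) (i j : Fin 2) (r s : ℂ) : Surface e :=
  Surface.mk e (chartCoords i j r s)

/-! ## Plane germs at the origin, blow-ups, multiplicity sequences -/

/-- Polynomials in two local coordinates `u = X 0`, `v = X 1`. -/
abbrev Poly₂ : Type := MvPolynomial (Fin 2) ℂ

/-- The multiplicity at the origin of the curve `f = 0`, that is, the least degree of a monomial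
occurring in `f`. -/
def mult (f : Poly₂) : ℕ := (f : MvPowerSeries (Fin 2) ℂ).order.toNat

/-- The germ at the origin of the curve `f = 0` is irreducible: `f` is irreducible in `ℂ⟦u,v⟧`. -/
def GermIrreducible (f : Poly₂) : Prop := Irreducible (f : MvPowerSeries (Fin 2) ℂ)

/-- The blow-up of the origin of the `(u,v)`-plane, in affine coordinates centred at a point of the
exceptional line `ℙ¹ = ℂ ∪ {∞}`. For the point `c : ℂ` it is `(u,v) ↦ (u, u (v + c))`, for the
point `∞`, written `none`, it is `(u,v) ↦ (u v, v)`. -/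
def blowup : Option ℂ → Poly₂ →ₐ[ℂ] Poly₂
  | some c => aeval ![X 0, X 0 * (X 1 + C c)]
  | none => aeval ![X 0 * X 1, X 1]

/-- The local equation of the exceptional line in the coordinates used in `blowup`. -/
def exceptional : Option ℂ → Poly₂
  | some _ => X 0
  | none => X 1

/-- `f'` is the equation of the strict transform of `f = 0` in the coordinates of `blowup d`:
the total transform divided by the exceptional line, taken as often as the multiplicity says. -/
def IsStrictTransform (d : Option ℂ) (f f' : Poly₂) : Prop :=
  blowup d f = exceptional d ^ mult f * f'

/-- The curve `f h = 0` has at the origin at most a normal crossing, and `f = 0` is smooth there: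
`f h` has multiplicity at most one, or it has multiplicity two and its quadratic part has two
distinct linear factors. Here `h` is the equation of the exceptional divisors (each smooth). -/
def IsSNC (f h : Poly₂) : Prop :=
  mult f ≤ 1 ∧
    (mult (f * h) ≤ 1 ∨
      (mult (f * h) = 2 ∧
        coeff (Finsupp.single 0 1 + Finsupp.single 1 1) (f * h) ^ 2 ≠
          4 * coeff (Finsupp.single 0 2) (f * h) * coeff (Finsupp.single 1 2) (f * h)))

/-- `HasMultSeq f h l`: starting with the strict transform `f = 0` and the reduced exceptional
divisor `h = 0` one blows up the point of the strict transform as long as the two do not form a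
simple normal crossing divisor; `l` is the list of the multiplicities of the strict transforms at
the points that are blown up. -/
inductive HasMultSeq : Poly₂ → Poly₂ → List ℕ → Prop
  | done (f h : Poly₂) : IsSNC f h → HasMultSeq f h []
  | step (f h : Poly₂) (d : Option ℂ) (f' h' : Poly₂) (l : List ℕ) :
      ¬ IsSNC f h →
      IsStrictTransform d f f' →
      coeff 0 f' = 0 →
      IsStrictTransform d h h' →
      HasMultSeq f' (exceptional d * h') l →
      HasMultSeq f h (mult f :: l)

/-- The compact notation for multiplicity sequences, which omits the ones at the end. -/
def compact (l : List ℕ) : List ℕ := l.rdropWhile (fun m => m = 1)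

/-! ## The geometric genus of a function field of one variable -/

/-- The differentials of `K / ℂ` that are regular at every place of `K / ℂ`: at each valuation ring
`V` of `K` that contains `ℂ` they are `V`-linear combinations of differentials of elements
of `V`. For the function field of a curve these are the global regular differential forms on the
normalization of the curve. -/
def regularDifferentials (K : Type) [Field K] [Algebra ℂ K] :
    Submodule ℂ (KaehlerDifferential ℂ K) where
  carrier := {ω | ∀ V : ValuationSubring K, (∀ z : ℂ, algebraMap ℂ K z ∈ V) →
    ω ∈ Submodule.span V.toSubring (Set.range fun x : V => KaehlerDifferential.D ℂ K (x : K))}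
  add_mem' := fun ha hb V hV => Submodule.add_mem _ (ha V hV) (hb V hV)
  zero_mem' := fun _ _ => Submodule.zero_mem _
  smul_mem' := fun z ω hω V hV => by
    have h := Submodule.smul_mem _ (⟨algebraMap ℂ K z, hV z⟩ : V.toSubring) (hω V hV)
    have e : (⟨algebraMap ℂ K z, hV z⟩ : V.toSubring) • ω = z • ω :=
      algebraMap_smul K z ω
    rwa [e] at h

/-- The geometric genus: the dimension of the space of global regular differential forms. -/
def geometricGenus (K : Type) [Field K] [Algebra ℂ K] : Cardinal :=
  Module.rank ℂ (regularDifferentials K)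

/-! ## Curves on Hirzebruch surfaces -/

/-- A reduced and irreducible curve of type `(a,b)` on `𝔽_e`: the zero set of an irreducible
polynomial which is homogeneous of bidegree `(a,b)`. -/
structure Curve (e : ℕ) (a b : ℤ) where
  /-- the defining polynomial -/
  eqn : CoxRing
  irreducible : Irreducible eqn
  homogeneous : IsWeightedHomogeneous (weight e) eqn (a, b)

namespace Curve

variable {e : ℕ} {a b : ℤ} (C : Curve e a b)

/-- The set of points of the curve. -/
def points : Set (Surface e) :=
  {p | ∃ z : Coords, Surface.mk e z = p ∧ eval z.1 C.eqn = 0}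

/-- The equation of the curve in the affine chart `x_i ≠ 0`, `y_j ≠ 0`, in affine coordinates `u`,
`v` centred at the point `(r,s)`. -/
def localEqn (i j : Fin 2) (r s : ℂ) : Poly₂ :=
  aeval (Sum.elim (fun k => if k = i then 1 else X 0 + MvPolynomial.C r)
    (fun k => if k = j then 1 else X 1 + MvPolynomial.C s) : Var → Poly₂) C.eqn

/-- `f` is a local equation of the curve at `p`, in coordinates of an affine chart around `p`
in which `p` is the origin. -/
def IsLocalEqn (p : Surface e) (f : Poly₂) : Prop :=
  ∃ (i j : Fin 2) (r s : ℂ), chartPoint e i j r s = p ∧ C.localEqn i j r s = f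

/-- `p` is a singular point of the curve. -/
def IsSingular (p : Surface e) : Prop :=
  p ∈ C.points ∧ ∃ f, C.IsLocalEqn p f ∧ 2 ≤ mult f

/-- `p` is a cusp of the curve: it is singular and the germ of the curve at `p` is irreducible. -/
def IsCusp (p : Surface e) : Prop :=
  C.IsSingular p ∧ ∃ f, C.IsLocalEqn p f ∧ GermIrreducible f

/-- The curve is cuspidal: all its singular points are cusps. -/
def IsCuspidal : Prop := ∀ p, C.IsSingular p → C.IsCusp p

/-- `l` is the multiplicity sequence `[m, m₁, …, m_{t-1}]` of the curve at `p`, where `t` is the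
number of blow-ups in the minimal embedded resolution at `p`. -/
def HasMultSeqAt (p : Surface e) (l : List ℕ) : Prop :=
  ∃ f, C.IsLocalEqn p f ∧ HasMultSeq f 1 l

/-- The collection (with repetitions) of the multiplicity sequences of the cusps of the curve, in
compact notation, is `conf`. -/
def HasCuspidalConfiguration (conf : Multiset (List ℕ)) : Prop :=
  ∃ (S : Finset (Surface e)) (m : Surface e → List ℕ),
    (∀ p, p ∈ S ↔ C.IsCusp p) ∧ (∀ p ∈ S, C.HasMultSeqAt p (m p)) ∧
      S.val.map (fun p => compact (m p)) = conf

/-- The homogeneous coordinate ring of the curve. -/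
abbrev CoordRing : Type := CoxRing ⧸ Ideal.span {C.eqn}

instance : IsDomain C.CoordRing := by
  have hp : Prime C.eqn := C.irreducible.prime
  have : (Ideal.span {C.eqn}).IsPrime := (Ideal.span_singleton_prime hp.ne_zero).2 hp
  exact Ideal.Quotient.isDomain _

/-- The class of a polynomial in the fraction field of the homogeneous coordinate ring. -/
def toFrac : CoxRing →ₐ[ℂ] FractionRing C.CoordRing :=
  (IsScalarTower.toAlgHom ℂ C.CoordRing (FractionRing C.CoordRing)).comp
    (Ideal.Quotient.mkₐ ℂ (Ideal.span {C.eqn}))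

/-- The function field of the curve: the quotients `G / H` of polynomials of the same bidegree,
where `H` does not vanish identically on the curve. -/
def functionField : IntermediateField ℂ (FractionRing C.CoordRing) where
  carrier := {q | ∃ (d : ℤ × ℤ) (G H : CoxRing), IsWeightedHomogeneous (weight e) G d ∧
    IsWeightedHomogeneous (weight e) H d ∧ C.toFrac H ≠ 0 ∧ q = C.toFrac G / C.toFrac H}
  mul_mem' := by
    rintro _ _ ⟨d, G, H, hG, hH, h0, rfl⟩ ⟨d', G', H', hG', hH', h0', rfl⟩
    refine ⟨d + d', G * G', H * H', hG.mul hG', hH.mul hH', ?_, ?_⟩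
    · rw [map_mul]; exact mul_ne_zero h0 h0'
    · rw [map_mul, map_mul, div_mul_div_comm]
  add_mem' := by
    rintro _ _ ⟨d, G, H, hG, hH, h0, rfl⟩ ⟨d', G', H', hG', hH', h0', rfl⟩
    refine ⟨d + d', G * H' + H * G', H * H', (hG.mul hH').add (hH.mul hG'), hH.mul hH', ?_, ?_⟩
    · rw [map_mul]; exact mul_ne_zero h0 h0'
    · rw [map_mul, map_add, map_mul, map_mul, div_add_div _ _ h0 h0']
  algebraMap_mem' := fun z =>
    ⟨0, MvPolynomial.C z, 1, isWeightedHomogeneous_C _ z, isWeightedHomogeneous_one _ _,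
      by rw [map_one]; exact one_ne_zero,
      by rw [map_one, div_one]; exact (C.toFrac.commutes z).symm⟩
  inv_mem' := by
    rintro _ ⟨d, G, H, hG, hH, h0, rfl⟩
    by_cases hz : C.toFrac G = 0
    · exact ⟨d, G, H, hG, hH, h0, by rw [hz]; simp⟩
    · exact ⟨d, H, G, hH, hG, hz, by rw [inv_div]⟩

/-- The curve is rational: its geometric genus is zero. -/
def IsRational : Prop := geometricGenus C.functionField = 0

end Curve

end Hirzebruch

end

/-!
The curve is the closure in `𝔽₂` of the three-cusped hypocycloid (deltoid)
`X² Y² - 4 X³ - 4 Y³ + 18 X Y - 27 = 0`, where `X = x₀ / x₁` and `Y = y₀ / (x₁² y₁)`. As a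
polynomial in `Y` it is a cubic whose coefficients have degrees `0, 2, 1, 3` in `X`, so that its
homogenization has bidegree `(0, 3)`. The left-hand side is the discriminant of
`z³ - Y z² + X z - 1`, so the double root `s` of this cubic parametrizes the curve by
`X = s² + 2 / s`, `Y = 2 s + 1 / s²`. Both derivatives vanish exactly at `s³ = 1`; these are the
three cusps `(3 ζ², 3 ζ)` with `ζ³ = 1`. In `𝔽₂` the end `s = ∞` becomes a fourth cusp, on the fibre
`x₁ = 0`, where the local equation is `v² - 4 u³ + ⋯ = 0`, while `s = 0` becomes a smooth point.

* *Irreducibility* (`irreducible_deltoidEqn`): up to a unit the equation is a monic cubic in `y₀`,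
  so it suffices that it has no root, and by a degree count `deltoid_no_polynomial_root` excludes
  one even after setting `x₁ = y₁ = 1`.
* *Rationality* (`isRational_deltoid`): `s` is a rational function of `X` and `Y`, so the function
  field is `ℂ(s)`. By `geometricGenus_eq_zero` a field `ℂ(s)` has no nonzero regular differential:
  regularity of `g ds` at all finite places makes `g` a polynomial, and then there is a pole at
  infinity.
* *Singular points* (`eq_cusp_of_isSingular`): the local equation and its two partial derivatives
  have no other common zeros than the four cusps, in any of the four charts.
* *Cusps* (`isCusp_and_hasMultSeqAt`): a double point whose quadratic part is the square of a linear
  form not dividing the cubic part has an irreducible germ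
  (`germIrreducible_of_quadratic_cubic`). Its first strict transform is smooth and simply tangent
  to the exceptional line, and two more blow-ups give normal crossings (`hasMultSeq_of_tangent`), so
  the multiplicity sequence is `[2, 1, 1]`, that is, `[2]` in compact notation.
-/

/-! ### Differentials of a rational function field -/

open Polynomial in
/-- The functional `dx ↦ dx/ds` on the differentials of `K = ℂ(s)`. It comes from
`Ω[ℂ[s]⁄ℂ] ≅ ℂ[s]` by base change along the formally étale extension `ℂ[s] → ℂ(s)`, and is an
isomorphism. -/
theorem exists_coordinate_functional {K : Type} [Field K] [Algebra ℂ K] (s : K)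
    (hs : Transcendental ℂ s) (hgen : ∀ x : K, ∃ p q : ℂ[X], q ≠ 0 ∧ x = aeval s p / aeval s q) :
    ∃ L : KaehlerDifferential ℂ K →ₗ[K] K, Function.Injective L ∧
      ∀ p : ℂ[X], L (KaehlerDifferential.D ℂ K (aeval s p)) = aeval s (derivative p) := by
  have hinj : Function.Injective (aeval s : ℂ[X] →ₐ[ℂ] K) :=
    transcendental_iff_injective.1 hs
  let _ : Algebra ℂ[X] K := (aeval s : ℂ[X] →ₐ[ℂ] K).toRingHom.toAlgebra
  have hmap : ∀ p : ℂ[X], algebraMap ℂ[X] K p = aeval s p := fun p => rfl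
  have : IsScalarTower ℂ ℂ[X] K := IsScalarTower.of_algebraMap_eq fun z => by
    rw [hmap, Polynomial.algebraMap_apply]; simp
  have : FaithfulSMul ℂ[X] K := (faithfulSMul_iff_algebraMap_injective _ _).2 hinj
  have : IsFractionRing ℂ[X] K := IsFractionRing.of_field _ _ fun x => by
    obtain ⟨p, q, -, h⟩ := hgen x
    exact ⟨p, q, h⟩
  have : Algebra.FormallyEtale ℂ[X] K :=
    Algebra.FormallyEtale.of_isLocalization (nonZeroDivisors ℂ[X])
  let e := (KaehlerDifferential.tensorKaehlerEquivOfFormallyEtale ℂ ℂ[X] K).symm ≪≫ₗ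
    (KaehlerDifferential.polynomialEquiv ℂ).baseChange ℂ[X] K _ _ ≪≫ₗ
      TensorProduct.AlgebraTensorModule.rid ℂ[X] K K
  refine ⟨e.toLinearMap, e.injective, fun p => ?_⟩
  rw [← hmap, ← hmap]
  simp [e, KaehlerDifferential.tensorKaehlerEquivOfFormallyEtale_symm_D_algebraMap,
    Algebra.smul_def]


open Polynomial in
/-- The valuation ring of the point `a` of the affine line with coordinate `s`. -/
def placeRing {K : Type} [Field K] [Algebra ℂ K] (s : K) (hs : Transcendental ℂ s)
    (hgen : ∀ x : K, ∃ p q : ℂ[X], q ≠ 0 ∧ x = aeval s p / aeval s q) (a : ℂ) :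
    ValuationSubring K where
  carrier := {x | ∃ p q : ℂ[X], q.eval a ≠ 0 ∧ x = aeval s p / aeval s q}
  mul_mem' := by
    rintro _ _ ⟨p, q, hq, rfl⟩ ⟨p', q', hq', rfl⟩
    exact ⟨p * p', q * q', by simp [hq, hq'], by simp [div_mul_div_comm]⟩
  one_mem' := ⟨1, 1, by simp, by simp⟩
  add_mem' := by
    rintro _ _ ⟨p, q, hq, rfl⟩ ⟨p', q', hq', rfl⟩
    have h (r : ℂ[X]) (hr : r.eval a ≠ 0) : aeval s r ≠ 0 := by
      rw [transcendental_iff] at hs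
      exact fun h => hr (by rw [hs r h, eval_zero])
    exact ⟨p * q' + q * p', q * q', by simp [hq, hq'], by
      rw [div_add_div _ _ (h q hq) (h q' hq')]; simp⟩
  zero_mem' := ⟨0, 1, by simp, by simp⟩
  neg_mem' := by
    rintro _ ⟨p, q, hq, rfl⟩
    exact ⟨-p, q, hq, by simp [neg_div]⟩
  mem_or_inv_mem' := by
    intro x
    obtain ⟨p, q, hq, rfl⟩ := hgen x
    by_cases hp : p = 0
    · exact Or.inl ⟨0, 1, by simp, by simp [hp]⟩
    have hX : aeval s (X - C a) ≠ 0 := fun h =>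
      X_sub_C_ne_zero a (transcendental_iff.1 hs _ h)
    have hpos {m n : ℕ} (hmn : n ≤ m) (u v : K) :
        aeval s (X - C a) ^ m * u / (aeval s (X - C a) ^ n * v) =
          aeval s (X - C a) ^ (m - n) * u / v := by
      obtain ⟨k, rfl⟩ := Nat.exists_eq_add_of_le hmn
      rw [pow_add, mul_assoc, mul_div_mul_left _ _ (pow_ne_zero _ hX), Nat.add_sub_cancel_left]
    obtain ⟨p', hp', hpa⟩ := exists_eq_pow_rootMultiplicity_mul_and_not_dvd p hp a
    obtain ⟨q', hq', hqa⟩ := exists_eq_pow_rootMultiplicity_mul_and_not_dvd q hq a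
    rw [dvd_iff_isRoot, IsRoot.def] at hpa hqa
    rw [hp', hq', map_mul, map_mul, map_pow, map_pow, inv_div]
    rcases le_total (rootMultiplicity a q) (rootMultiplicity a p) with h | h
    · left
      exact ⟨(X - C a) ^ (rootMultiplicity a p - rootMultiplicity a q) * p', q', hqa, by
        rw [hpos h, map_mul, map_pow]⟩
    · right
      exact ⟨(X - C a) ^ (rootMultiplicity a q - rootMultiplicity a p) * q', p', hpa, by
        rw [hpos h, map_mul, map_pow]⟩

open Polynomial Hirzebruch in
/-- If `L` sends `dx` to `dx/ds`, then it sends a regular differential `g ds` to a function `g`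
without pole at any finite value of `s`: the derivative of a function that is regular at a point
is again regular there. -/
theorem exists_eq_div_of_mem_regularDifferentials {K : Type} [Field K] [Algebra ℂ K] (s : K)
    (hs : Transcendental ℂ s) (hgen : ∀ x : K, ∃ p q : ℂ[X], q ≠ 0 ∧ x = aeval s p / aeval s q)
    (L : KaehlerDifferential ℂ K →ₗ[K] K)
    (hL : ∀ p : ℂ[X], L (KaehlerDifferential.D ℂ K (aeval s p)) = aeval s (derivative p))
    (ω : KaehlerDifferential ℂ K) (hω : ω ∈ regularDifferentials K) (a : ℂ) :
    ∃ p q : ℂ[X], q.eval a ≠ 0 ∧ L ω = aeval s p / aeval s q := by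
  have hC (z : ℂ) : algebraMap ℂ K z ∈ placeRing s hs hgen a := ⟨C z, 1, by simp, by simp⟩
  suffices L ω ∈ placeRing s hs hgen a from this
  refine Submodule.span_induction (p := fun ω _ => L ω ∈ placeRing s hs hgen a)
    ?_ ?_ ?_ ?_ (hω (placeRing s hs hgen a) hC)
  · rintro _ ⟨⟨x, p, q, hq, rfl⟩, rfl⟩
    refine ⟨q * derivative p - p * derivative q, q ^ 2, by simpa using hq, ?_⟩
    change L (KaehlerDifferential.D ℂ K (aeval s p / aeval s q)) = _
    rw [Derivation.leibniz_div, map_smul, map_sub, map_smul, map_smul, hL, hL]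
    simp only [smul_eq_mul, map_sub, map_mul, map_pow]
    rw [div_eq_inv_mul, inv_pow]
  · rw [map_zero]; exact zero_mem _
  · intro x y _ _ hx hy
    rw [map_add]; exact add_mem hx hy
  · intro v x _ hx
    have : L (v • x) = (v : K) * L x := by
      rw [← smul_eq_mul, ← map_smul]; rfl
    rw [this]
    exact mul_mem v.2 hx

open Polynomial in
theorem aeval_inv_reverse {K : Type} [Field K] [Algebra ℂ K] {s : K} (h0 : s ≠ 0) (p : ℂ[X]) :
    aeval s p = s ^ p.natDegree * aeval s⁻¹ p.reverse := by
  have : Invertible s := invertibleOfNonzero h0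
  have h := eval₂_reverse_mul_pow (algebraMap ℂ K) s p
  rw [invOf_eq_inv] at h
  rw [aeval_def, aeval_def, ← h, mul_comm]

open Polynomial Hirzebruch in
/-- A purely transcendental function field has genus zero: if `g ds` is regular at all finite
places then `g` is a polynomial in `s`, and regularity at `s = ∞`, where `ds = -s² d(1/s)`, forces
`g s²` to be regular at infinity. -/
theorem geometricGenus_eq_zero {K : Type} [Field K] [Algebra ℂ K] (s : K)
    (hs : Transcendental ℂ s) (hgen : ∀ x : K, ∃ p q : ℂ[X], q ≠ 0 ∧ x = aeval s p / aeval s q) :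
    geometricGenus K = 0 := by
  have h0 : s ≠ 0 := by rintro rfl; exact hs isAlgebraic_zero
  have hz {p : ℂ[X]} (hp : aeval s p = 0) : p = 0 := transcendental_iff.1 hs p hp
  have hpow (n : ℕ) : s ^ n * s⁻¹ ^ n = 1 := by rw [← mul_pow, mul_inv_cancel₀ h0, one_pow]
  have ht : Transcendental ℂ s⁻¹ := fun h => hs (by simpa using h.inv)
  have hgent : ∀ x : K, ∃ p q : ℂ[X], q ≠ 0 ∧ x = aeval s⁻¹ p / aeval s⁻¹ q := by
    intro x
    obtain ⟨p, q, hq, rfl⟩ := hgen x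
    refine ⟨p.reverse * X ^ q.natDegree, q.reverse * X ^ p.natDegree, by simpa using hq, ?_⟩
    have hq' : aeval s⁻¹ q.reverse ≠ 0 := fun h =>
      hq (by simpa using transcendental_iff.1 ht _ h)
    rw [aeval_inv_reverse h0 p, aeval_inv_reverse h0 q]
    simp only [map_mul, map_pow, aeval_X]
    generalize aeval s⁻¹ p.reverse = u, aeval s⁻¹ q.reverse = v at *
    rw [div_eq_div_iff (mul_ne_zero (pow_ne_zero _ h0) hq')
      (mul_ne_zero hq' (pow_ne_zero _ (inv_ne_zero h0)))]
    linear_combination u * v * hpow p.natDegree - u * v * hpow q.natDegree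
  obtain ⟨L, hLinj, hL⟩ := exists_coordinate_functional s hs hgen
  obtain ⟨L', -, hL'⟩ := exists_coordinate_functional s⁻¹ ht hgent
  unfold geometricGenus
  suffices regularDifferentials K = ⊥ by rw [this]; simp
  rw [eq_bot_iff]
  intro ω hω
  rw [Submodule.mem_bot]
  apply hLinj
  rw [map_zero]
  by_contra hg
  have hD : ω = L ω • KaehlerDifferential.D ℂ K s := hLinj (by
    have := hL X
    simp only [aeval_X, derivative_X, map_one] at this
    rw [map_smul, this, smul_eq_mul, mul_one])
  have hD' : L' ω = -(L ω * s ^ 2) := by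
    have := hL' X
    simp only [aeval_X, derivative_X, map_one] at this
    have h2 : KaehlerDifferential.D ℂ K s = -(s ^ 2) • KaehlerDifferential.D ℂ K s⁻¹ := by
      rw [Derivation.leibniz_inv, smul_smul, neg_mul_neg, ← mul_pow, mul_inv_cancel₀ h0, one_pow,
        one_smul]
    conv_lhs => rw [hD, h2, map_smul, map_smul, this]
    simp
  obtain ⟨p, q, hq, hpq⟩ := hgen (L ω)
  -- A zero of `q` of higher multiplicity than in `p` would be a pole of `L ω`, so `q ∣ p`.
  obtain ⟨P, hP⟩ : ∃ P : ℂ[X], L ω = aeval s P := by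
    obtain ⟨u, hu⟩ : q ∣ p := by
      by_cases hp : p = 0
      · simp [hp]
      rw [IsAlgClosed.dvd_iff_roots_le_roots hq hp, Multiset.le_iff_count]
      intro a
      rw [count_roots, count_roots]
      obtain ⟨p', q', hq', h⟩ :=
        exists_eq_div_of_mem_regularDifferentials s hs hgen L hL ω hω a
      have hq0 : q' ≠ 0 := by rintro rfl; simp at hq'
      rw [hpq, div_eq_div_iff (fun h => hq (hz h)) (fun h => hq0 (hz h)), ← map_mul, ← map_mul,
        ← sub_eq_zero, ← map_sub] at h
      have h' : p * q' = p' * q := sub_eq_zero.1 (hz h)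
      have h1 : rootMultiplicity a (p * q') = rootMultiplicity a (p' * q) := by rw [h']
      rw [rootMultiplicity_mul (mul_ne_zero hp hq0),
        rootMultiplicity_mul (h' ▸ mul_ne_zero hp hq0),
        rootMultiplicity_eq_zero (p := q') hq'] at h1
      omega
    refine ⟨u, ?_⟩
    rw [hpq, hu, map_mul, mul_div_cancel_left₀ _ (fun h => hq (hz h))]
  obtain ⟨p', q', hq', h⟩ :=
    exists_eq_div_of_mem_regularDifferentials s⁻¹ ht hgent L' hL' ω hω 0
  have hq0 : aeval s⁻¹ q' ≠ 0 := fun h => by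
    rw [transcendental_iff.1 ht _ h] at hq'; simp at hq'
  rw [hD', hP, aeval_inv_reverse h0 P, eq_div_iff hq0] at h
  have h1 : aeval s⁻¹ (P.reverse * q' + X ^ (P.natDegree + 2) * p') = 0 := by
    simp only [map_add, map_mul, map_pow, aeval_X, ← h]
    linear_combination -aeval s⁻¹ P.reverse * aeval s⁻¹ q' * hpow (P.natDegree + 2)
  have h2 := congrArg (eval 0) (transcendental_iff.1 ht _ h1)
  simp only [eval_add, eval_mul, eval_pow, eval_X, eval_zero, ← coeff_zero_eq_eval_zero,
    coeff_zero_reverse] at h2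
  rw [coeff_zero_eq_eval_zero] at h2
  simp [hq'] at h2
  rw [h2] at hP
  exact hg (by simpa using hP)

/-! ### Coefficients, multiplicity and irreducibility of plane germs -/

/-- The exponent of the monomial `u ^ i * v ^ j`. -/
noncomputable def biexp (i j : ℕ) : Fin 2 →₀ ℕ := Finsupp.single 0 i + Finsupp.single 1 j

theorem biexp_zero (i j : ℕ) : biexp i j 0 = i := by simp [biexp]

theorem biexp_one (i j : ℕ) : biexp i j 1 = j := by simp [biexp]

theorem eq_biexp (d : Fin 2 →₀ ℕ) : d = biexp (d 0) (d 1) := by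
  ext i; fin_cases i <;> simp [biexp]

theorem biexp_inj {i j k l : ℕ} : biexp i j = biexp k l ↔ i = k ∧ j = l := by
  refine ⟨fun h => ⟨?_, ?_⟩, by rintro ⟨rfl, rfl⟩; rfl⟩
  · simpa [biexp] using DFunLike.congr_fun h 0
  · simpa [biexp] using DFunLike.congr_fun h 1

theorem degree_biexp (i j : ℕ) : (biexp i j).degree = i + j := by simp [biexp]

theorem sum_antidiagonal_biexp {M : Type*} [AddCommMonoid M] (a b : ℕ)
    (φ : (Fin 2 →₀ ℕ) → (Fin 2 →₀ ℕ) → M) :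
    ∑ d ∈ Finset.HasAntidiagonal.antidiagonal (biexp a b), φ d.1 d.2 =
      ∑ p ∈ Finset.HasAntidiagonal.antidiagonal a, ∑ q ∈ Finset.HasAntidiagonal.antidiagonal b,
        φ (biexp p.1 q.1) (biexp p.2 q.2) := by
  rw [← Finset.sum_product']
  symm
  refine Finset.sum_bij (fun x _ => (biexp x.1.1 x.2.1, biexp x.1.2 x.2.2)) ?_ ?_ ?_ ?_
  · rintro ⟨⟨p, p'⟩, ⟨q, q'⟩⟩ h
    simp only [Finset.mem_product, Finset.HasAntidiagonal.mem_antidiagonal] at h ⊢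
    obtain ⟨rfl, rfl⟩ := h
    simp only [biexp, Finsupp.single_add]
    abel
  · rintro ⟨⟨p, p'⟩, ⟨q, q'⟩⟩ - ⟨⟨r, r'⟩, ⟨s, s'⟩⟩ - h
    simp only [Prod.mk.injEq, biexp_inj] at h ⊢
    tauto
  · rintro ⟨d, d'⟩ h
    rw [Finset.HasAntidiagonal.mem_antidiagonal] at h
    refine ⟨((d 0, d' 0), (d 1, d' 1)), ?_, ?_⟩
    · simp only [Finset.mem_product, Finset.HasAntidiagonal.mem_antidiagonal, ← Finsupp.add_apply, h, biexp_zero,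
        biexp_one, and_self]
    · simp only [← eq_biexp]
  · intros; rfl

theorem MvPowerSeries.coeff_biexp_mul (a b : ℕ) (g h : MvPowerSeries (Fin 2) ℂ) :
    MvPowerSeries.coeff (biexp a b) (g * h) =
      ∑ i ∈ Finset.range (a + 1), ∑ j ∈ Finset.range (b + 1),
        MvPowerSeries.coeff (biexp i j) g * MvPowerSeries.coeff (biexp (a - i) (b - j)) h := by
  rw [MvPowerSeries.coeff_mul, sum_antidiagonal_biexp a b fun d d' =>
    MvPowerSeries.coeff d g * MvPowerSeries.coeff d' h]
  simp only [Finset.Nat.sum_antidiagonal_eq_sum_range_succ_mk]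

namespace Hirzebruch
open MvPolynomial

theorem coeff_biexp_mul (a b : ℕ) (g h : Poly₂) :
    coeff (biexp a b) (g * h) =
      ∑ i ∈ Finset.range (a + 1), ∑ j ∈ Finset.range (b + 1),
        coeff (biexp i j) g * coeff (biexp (a - i) (b - j)) h := by
  simp only [← MvPolynomial.coeff_coe, MvPolynomial.coe_mul, MvPowerSeries.coeff_biexp_mul]

theorem coeff_biexp_X_zero_pow (a b n : ℕ) :
    coeff (biexp a b) (X 0 ^ n : Poly₂) = if a = n ∧ b = 0 then 1 else 0 := by
  have : (Finsupp.single 0 n : Fin 2 →₀ ℕ) = biexp n 0 := by simp [biexp]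
  rw [coeff_X_pow, this]
  simp only [biexp_inj, eq_comm]

theorem coeff_biexp_X_one_pow (a b n : ℕ) :
    coeff (biexp a b) (X 1 ^ n : Poly₂) = if a = 0 ∧ b = n then 1 else 0 := by
  have : (Finsupp.single 1 n : Fin 2 →₀ ℕ) = biexp 0 n := by simp [biexp]
  rw [coeff_X_pow, this]
  simp only [biexp_inj, eq_comm]

theorem coeff_biexp_X_zero (a b : ℕ) :
    coeff (biexp a b) (X 0 : Poly₂) = if a = 1 ∧ b = 0 then 1 else 0 := by
  simpa using coeff_biexp_X_zero_pow a b 1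

theorem coeff_biexp_X_one (a b : ℕ) :
    coeff (biexp a b) (X 1 : Poly₂) = if a = 0 ∧ b = 1 then 1 else 0 := by
  simpa using coeff_biexp_X_one_pow a b 1

theorem coeff_biexp_C (a b : ℕ) (z : ℂ) :
    coeff (biexp a b) (C z : Poly₂) = if a = 0 ∧ b = 0 then z else 0 := by
  have : (0 : Fin 2 →₀ ℕ) = biexp 0 0 := by simp [biexp]
  rw [coeff_C, this]
  simp only [biexp_inj, eq_comm]

theorem coeff_biexp_C_mul (a b : ℕ) (z : ℂ) (f : Poly₂) :
    coeff (biexp a b) (C z * f) = z * coeff (biexp a b) f := coeff_C_mul ..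

theorem coeff_zero_eq_biexp (f : Poly₂) : coeff 0 f = coeff (biexp 0 0) f := by simp [biexp]

theorem mult_eq {f : Poly₂} {n : ℕ} (h : ∀ i j, i + j < n → coeff (biexp i j) f = 0)
    {i j : ℕ} (hij : i + j = n) (hne : coeff (biexp i j) f ≠ 0) : mult f = n := by
  have : (f : MvPowerSeries (Fin 2) ℂ).order = n := by
    rw [MvPowerSeries.order_eq_nat]
    refine ⟨⟨biexp i j, by rwa [MvPolynomial.coeff_coe], by rw [degree_biexp, hij]⟩,
      fun d hd => ?_⟩
    rw [eq_biexp d, degree_biexp] at hd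
    rw [MvPolynomial.coeff_coe, eq_biexp d]
    exact h _ _ hd
  rw [mult, this, ENat.toNat_natCast]

theorem mult_eq_zero {f : Poly₂} (h : coeff (biexp 0 0) f ≠ 0) : mult f = 0 :=
  mult_eq (i := 0) (j := 0) (by omega) rfl h

theorem mult_eq_one {f : Poly₂} (h : coeff (biexp 0 0) f = 0)
    (h' : coeff (biexp 1 0) f ≠ 0 ∨ coeff (biexp 0 1) f ≠ 0) : mult f = 1 := by
  have h0 : ∀ i j, i + j < 1 → coeff (biexp i j) f = 0 := by
    intro i j hij
    obtain ⟨rfl, rfl⟩ : i = 0 ∧ j = 0 := by omega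
    exact h
  rcases h' with h' | h'
  · exact mult_eq h0 rfl h'
  · exact mult_eq h0 rfl h'

theorem coeff_eq_zero_of_lt_mult {f : Poly₂} {i j : ℕ} (h : i + j < mult f) :
    coeff (biexp i j) f = 0 := by
  rw [← MvPolynomial.coeff_coe]
  refine MvPowerSeries.coeff_of_lt_order ?_
  rw [degree_biexp]
  refine lt_of_lt_of_le (Nat.cast_lt.2 h) ?_
  exact ENat.natCast_toNat_le_self _

theorem isSNC_iff (f h : Poly₂) : IsSNC f h ↔ mult f ≤ 1 ∧ (mult (f * h) ≤ 1 ∨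
    (mult (f * h) = 2 ∧ coeff (biexp 1 1) (f * h) ^ 2 ≠
      4 * coeff (biexp 2 0) (f * h) * coeff (biexp 0 2) (f * h))) := by
  simp [IsSNC, biexp]

/-- A germ whose quadratic part is a nonzero square `k (α u + β v)²`, and whose cubic part does not
vanish on the line `α u + β v = 0`, is irreducible: both factors of a proper factorization would be
smooth and tangent to this line, so that the cubic part would vanish on it. -/
theorem germIrreducible_of_quadratic_cubic {f : Poly₂} {k α β : ℂ} (hk : k ≠ 0)
    (hαβ : α ≠ 0 ∨ β ≠ 0) (h0 : coeff (biexp 0 0) f = 0)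
    (h20 : coeff (biexp 2 0) f = k * α ^ 2) (h11 : coeff (biexp 1 1) f = 2 * k * α * β)
    (h02 : coeff (biexp 0 2) f = k * β ^ 2)
    (h3 : coeff (biexp 3 0) f * β ^ 3 - coeff (biexp 2 1) f * β ^ 2 * α +
      coeff (biexp 1 2) f * β * α ^ 2 - coeff (biexp 0 3) f * α ^ 3 ≠ 0) :
    GermIrreducible f := by
  have hz : (0 : Fin 2 →₀ ℕ) = biexp 0 0 := by simp [biexp]
  have hunit (g : MvPowerSeries (Fin 2) ℂ) :
      ¬ IsUnit g ↔ MvPowerSeries.coeff (biexp 0 0) g = 0 := by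
    rw [MvPowerSeries.isUnit_iff_constantCoeff, isUnit_iff_ne_zero, not_not, ← hz,
      MvPowerSeries.coeff_zero_eq_constantCoeff_apply]
  refine ⟨(hunit _).2 (by rw [MvPolynomial.coeff_coe, h0]), fun g h hgh => ?_⟩
  by_contra! hc
  rw [hunit, hunit] at hc
  obtain ⟨hg, hh⟩ := hc
  simp only [← MvPolynomial.coeff_coe, hgh, MvPowerSeries.coeff_biexp_mul, Finset.sum_range_succ,
    Finset.range_zero, Finset.sum_empty, Nat.reduceAdd, Nat.reduceSub, hg, hh, zero_mul, mul_zero,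
    add_zero, zero_add] at h20 h11 h02 h3
  set A := MvPowerSeries.coeff (biexp 1 0) g
  set B := MvPowerSeries.coeff (biexp 0 1) g
  set A' := MvPowerSeries.coeff (biexp 1 0) h
  set B' := MvPowerSeries.coeff (biexp 0 1) h
  -- The linear parts `A u + B v` and `A' u + B' v` are both proportional to `α u + β v`.
  have hd : A * B' - B * A' = 0 := pow_eq_zero_iff two_ne_zero |>.1 (by
    linear_combination (A * B' + B * A' + 2 * k * α * β) * h11 - 4 * B * B' * h20 -
      4 * k * α ^ 2 * h02)
  have hL : A * β - B * α = 0 := by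
    have h1 : k * α * (A * β - B * α) = 0 := by
      linear_combination B * h20 - A / 2 * h11 + A / 2 * hd
    have h2 : k * β * (A * β - B * α) = 0 := by
      linear_combination B / 2 * h11 - A * h02 + B / 2 * hd
    rcases hαβ with h | h
    · exact (mul_eq_zero.1 h1).resolve_left (mul_ne_zero hk h)
    · exact (mul_eq_zero.1 h2).resolve_left (mul_ne_zero hk h)
  have hL' : A' * β - B' * α = 0 := by
    have h1 : k * α * (A' * β - B' * α) = 0 := by
      linear_combination B' * h20 - A' / 2 * h11 - A' / 2 * hd
    have h2 : k * β * (A' * β - B' * α) = 0 := by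
      linear_combination B' / 2 * h11 - A' * h02 - B' / 2 * hd
    rcases hαβ with h | h
    · exact (mul_eq_zero.1 h1).resolve_left (mul_ne_zero hk h)
    · exact (mul_eq_zero.1 h2).resolve_left (mul_ne_zero hk h)
  apply h3
  set c20 := MvPowerSeries.coeff (biexp 2 0) g
  set c11 := MvPowerSeries.coeff (biexp 1 1) g
  set c02 := MvPowerSeries.coeff (biexp 0 2) g
  set d20 := MvPowerSeries.coeff (biexp 2 0) h
  set d11 := MvPowerSeries.coeff (biexp 1 1) h
  set d02 := MvPowerSeries.coeff (biexp 0 2) h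
  linear_combination (d20 * β ^ 2 - d11 * α * β + d02 * α ^ 2) * hL +
    (c20 * β ^ 2 - c11 * α * β + c02 * α ^ 2) * hL'

end Hirzebruch

/-! ### The embedded resolution of an ordinary cusp -/

namespace Hirzebruch
open MvPolynomial

theorem coeff_biexp_zero_zero (f : Poly₂) : coeff (biexp 0 0) f = constantCoeff f := by
  rw [← coeff_zero_eq_biexp]; rfl

theorem exists_eq_C_add (B : Poly₂) :
    ∃ B₁ B₂ : Poly₂, B = C (constantCoeff B) + X 0 * B₁ + X 1 * B₂ := by
  induction B using MvPolynomial.induction_on with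
  | C a => exact ⟨0, 0, by simp⟩
  | add p q hp hq =>
    obtain ⟨p₁, p₂, hp⟩ := hp
    obtain ⟨q₁, q₂, hq⟩ := hq
    refine ⟨p₁ + q₁, p₂ + q₂, ?_⟩
    rw [map_add, map_add]
    linear_combination hp + hq
  | mul_X p i hp =>
    fin_cases i
    · exact ⟨p, 0, by simp [mul_comm]⟩
    · exact ⟨0, p, by simp [mul_comm]⟩

theorem HasMultSeq.step_of_mult_eq {f h f' h' : Poly₂} {l : List ℕ} {n k : ℕ} (d : Option ℂ)
    (hn : mult f = n) (hk : mult h = k) (hsnc : ¬ IsSNC f h)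
    (hf : blowup d f = exceptional d ^ n * f') (h0 : constantCoeff f' = 0)
    (hh : blowup d h = exceptional d ^ k * h') (hl : HasMultSeq f' (exceptional d * h') l) :
    HasMultSeq f h (n :: l) := by
  subst hn hk
  exact HasMultSeq.step f h d f' h' l hsnc hf h0 hh hl

theorem mult_X_one_mul_X_zero : mult (X 1 * X 0) = 2 := by
  refine mult_eq (i := 1) (j := 1) ?_ rfl ?_
  · intro i j hij
    have hi : i < 2 := by omega
    have hj : j < 2 := by omega
    interval_cases i <;> interval_cases j <;> first | omega |
    simp [coeff_biexp_mul, Finset.sum_range_succ, coeff_biexp_X_zero, coeff_biexp_X_one]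
  · simp [coeff_biexp_mul, Finset.sum_range_succ, coeff_biexp_X_zero, coeff_biexp_X_one]

/-- A smooth germ through the node `u v = 0` of the exceptional divisor that is transversal to both
branches needs one blow-up. -/
theorem hasMultSeq_of_transversal {A : ℂ} (hA : A ≠ 0) {B : Poly₂} (hB : constantCoeff B ≠ 0) :
    HasMultSeq (C A * X 1 + X 0 * B) (X 1 * X 0) [1] := by
  obtain ⟨B₁, B₂, hB'⟩ := exists_eq_C_add B
  have hm : mult (C A * X 1 + X 0 * B) = 1 := by
    refine mult_eq_one ?_ (Or.inr ?_) <;>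
    simp [coeff_biexp_mul, Finset.sum_range_succ, coeff_biexp_X_zero, coeff_biexp_X_one,
      hA]
  -- The direction `v = c u` of the tangent.
  obtain ⟨c, hc⟩ : ∃ c : ℂ, A * c + constantCoeff B = 0 :=
    ⟨-constantCoeff B / A, by field_simp; ring⟩
  have hc0 : c ≠ 0 := by rintro rfl; simp [hB] at hc
  have hAc : C A * C c + C (constantCoeff B) = (0 : Poly₂) := by
    rw [← C_mul, ← C_add, hc, C_0]
  refine HasMultSeq.step_of_mult_eq (some c)
    (f' := C A * X 1 + X 0 * (blowup (some c) B₁ + (X 1 + C c) * blowup (some c) B₂))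
    (h' := X 1 + C c) hm mult_X_one_mul_X_zero ?_ ?_ ?_ ?_ (HasMultSeq.done _ _ ?_)
  · have h3 : mult ((C A * X 1 + X 0 * B) * (X 1 * X 0)) = 3 := by
      refine mult_eq (i := 1) (j := 2) ?_ rfl ?_
      · intro i j hij
        have hi : i < 3 := by omega
        have hj : j < 3 := by omega
        interval_cases i <;> interval_cases j <;> first | omega |
        simp [coeff_biexp_mul, Finset.sum_range_succ, coeff_biexp_X_zero, coeff_biexp_X_one]
      · simp [coeff_biexp_mul, Finset.sum_range_succ, coeff_biexp_X_zero, coeff_biexp_X_one,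
          hA]
    rw [isSNC_iff, h3]
    omega
  · conv_lhs => rw [hB']
    simp only [blowup, exceptional, map_add, map_mul, aeval_X, aeval_C, algebraMap_eq,
      Matrix.cons_val_zero, Matrix.cons_val_one]
    linear_combination X 0 * hAc
  · simp
  · simp [blowup, exceptional]
    ring
  · generalize blowup (some c) B₁ + (X 1 + C c) * blowup (some c) B₂ = D
    rw [isSNC_iff]
    have h1 : mult (C A * X 1 + X 0 * D) = 1 := by
      refine mult_eq_one ?_ (Or.inr ?_) <;>
      simp [coeff_biexp_mul, Finset.sum_range_succ, coeff_biexp_X_zero, coeff_biexp_X_one,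
        hA]
    have h2 : mult ((C A * X 1 + X 0 * D) * (X 0 * (X 1 + C c))) = 2 := by
      refine mult_eq (i := 1) (j := 1) ?_ rfl ?_
      · intro i j hij
        have hi : i < 2 := by omega
        have hj : j < 2 := by omega
        interval_cases i <;> interval_cases j <;> first | omega |
        simp [coeff_biexp_mul, Finset.sum_range_succ, coeff_biexp_X_zero, coeff_biexp_X_one]
      · simp [coeff_biexp_mul, Finset.sum_range_succ, coeff_biexp_X_zero, coeff_biexp_X_one,
          coeff_biexp_C, -coeff_C, hA, hc0]
    refine ⟨h1.le, Or.inr ⟨h2, ?_⟩⟩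
    simp [exceptional, coeff_biexp_mul, Finset.sum_range_succ, coeff_biexp_X_zero,
      coeff_biexp_X_one, coeff_biexp_C, -coeff_C, hA, hc0]

/-- A smooth germ `A v² + u B`, `B(0) ≠ 0`, together with the exceptional line `u = 0`, to which it
is simply tangent, needs two blow-ups to become a simple normal crossing divisor. -/
theorem hasMultSeq_of_tangent {A : ℂ} (hA : A ≠ 0) {B : Poly₂} (hB : constantCoeff B ≠ 0) :
    HasMultSeq (C A * X 1 ^ 2 + X 0 * B) (X 0) [1, 1] := by
  have hm : mult (C A * X 1 ^ 2 + X 0 * B) = 1 := by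
    refine mult_eq_one ?_ (Or.inl ?_) <;>
    simp [coeff_biexp_mul, coeff_biexp_X_zero, coeff_biexp_X_one_pow,
      coeff_biexp_zero_zero]
    exact hB
  have hX : mult (X 0) = 1 := by
    refine mult_eq_one ?_ (Or.inl ?_) <;> simp [coeff_biexp_X_zero]
  obtain ⟨B₁, B₂, hB'⟩ := exists_eq_C_add B
  have hb : constantCoeff (blowup none B) ≠ 0 := by
    rw [hB']
    simpa [blowup] using hB
  refine HasMultSeq.step_of_mult_eq none (f' := C A * X 1 + X 0 * blowup none B) (h' := X 0)
    hm hX ?_ ?_ ?_ ?_ (hasMultSeq_of_transversal hA hb)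
  · have h2 : mult ((C A * X 1 ^ 2 + X 0 * B) * X 0) = 2 := by
      refine mult_eq (i := 2) (j := 0) ?_ rfl ?_
      · intro i j hij
        have hi : i < 2 := by omega
        have hj : j < 2 := by omega
        interval_cases i <;> interval_cases j <;> first | omega |
        simp [coeff_biexp_mul, Finset.sum_range_succ, coeff_biexp_X_zero, coeff_biexp_X_one_pow]
      · simp [coeff_biexp_mul, Finset.sum_range_succ, coeff_biexp_X_zero, coeff_biexp_X_one_pow,
          coeff_biexp_zero_zero]
        exact hB
    rw [isSNC_iff, h2]
    simp [coeff_biexp_mul, Finset.sum_range_succ, coeff_biexp_X_zero, coeff_biexp_X_one_pow]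
  · simp only [blowup, exceptional, map_add, map_mul, map_pow, aeval_X, aeval_C, algebraMap_eq,
      Matrix.cons_val_zero, Matrix.cons_val_one]
    ring
  · simp
  · simp [blowup, exceptional, mul_comm]

/-- A double point whose first blow-up is smooth and simply tangent to the exceptional line is an
ordinary cusp: its resolution takes three blow-ups. -/
theorem hasMultSeq_of_blowup {f B : Poly₂} {A c : ℂ} (hA : A ≠ 0) (hB : constantCoeff B ≠ 0)
    (hm : mult f = 2) (hf : blowup (some c) f = X 0 ^ 2 * (C A * X 1 ^ 2 + X 0 * B)) :
    HasMultSeq f 1 [2, 1, 1] := by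
  have h1 : mult 1 = 0 := mult_eq_zero (by simp [coeff_biexp_zero_zero])
  refine HasMultSeq.step_of_mult_eq (some c) (h' := 1) hm h1 ?_ hf ?_ ?_ ?_
  · rw [isSNC_iff, hm]
    omega
  · simp
  · simp
  · rw [mul_one]
    exact hasMultSeq_of_tangent hA hB

theorem compact_two_one_one : compact [2, 1, 1] = [2] := by
  simp [compact, List.rdropWhile]

end Hirzebruch

/-! ### The deltoid and its irreducibility -/

open Polynomial in
/-- The deltoid equation, a cubic in its second coordinate, has no polynomial solution. -/
theorem deltoid_no_polynomial_root (r : ℂ[X]) :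
    r ^ 2 * (X ^ 2 - 4 * r) ≠ 4 * X ^ 3 + 27 - 18 * X * r := by
  intro h
  have hC4 : (4 : ℂ[X]) = C 4 := (map_ofNat C 4).symm
  have hC18 : (18 : ℂ[X]) = C 18 := (map_ofNat C 18).symm
  have hC27 : (27 : ℂ[X]) = C 27 := (map_ofNat C 27).symm
  have hev (x : ℂ) := congrArg (eval x) h
  simp only [eval_mul, eval_pow, eval_sub, eval_add, eval_X, eval_ofNat] at hev
  have hW : X ^ 2 - 4 * r ≠ 0 := by
    intro hW
    have h1 := congrArg (eval 0) hW
    have h0 := hev 0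
    simp at h1 h0
    simp [h1] at h0
  have hr : r ≠ 0 := by
    rintro rfl
    have h0 := hev 0
    simp at h0
  have hdeg : 2 * r.natDegree + (X ^ 2 - 4 * r).natDegree ≤ max 3 (r.natDegree + 1) := by
    rw [← natDegree_pow, ← natDegree_mul (pow_ne_zero 2 hr) hW, h]
    refine (natDegree_sub_le _ _).trans (max_le_max ?_ ?_)
    · rw [hC4, hC27]; compute_degree
    · rw [hC18, mul_assoc]
      refine (natDegree_C_mul_le _ _).trans (natDegree_mul_le.trans ?_)
      rw [natDegree_X, add_comm]
  obtain ⟨b, a, rfl⟩ := exists_eq_X_add_C_of_natDegree_le_one (p := r) (by omega)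
  simp only [eval_mul, eval_add, eval_C, eval_X] at hev
  -- Fourth and third differences isolate the coefficients of `X ^ 4` and `X ^ 3`.
  have hb : b = 0 := pow_eq_zero_iff two_ne_zero |>.1 (by
    linear_combination (hev 2 - 4 * hev 1 + 6 * hev 0 - 4 * hev (-1) + hev (-2)) / 24)
  subst hb
  have : (48 : ℂ) = 0 := by
    linear_combination -hev 2 + 2 * hev 1 - 2 * hev (-1) + hev (-2)
  norm_num at this

namespace Hirzebruch
open MvPolynomial

/-- The homogeneous form of `X ^ 2 * Y ^ 2 - 4 * X ^ 3 - 4 * Y ^ 3 + 18 * X * Y - 27`, the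
discriminant of `z ^ 3 - Y * z ^ 2 + X * z - 1`, where `X = x₀ / x₁` and
`Y = y₀ / (x₁ ^ 2 * y₁)`. -/
noncomputable def deltoidEqn : CoxRing :=
  C (-4) * X (Sum.inr 0) ^ 3 + X (Sum.inl 0) ^ 2 * X (Sum.inr 0) ^ 2 * X (Sum.inr 1) +
    C 18 * X (Sum.inl 0) * X (Sum.inl 1) ^ 3 * X (Sum.inr 0) * X (Sum.inr 1) ^ 2 +
    (C (-4) * X (Sum.inl 0) ^ 3 * X (Sum.inl 1) ^ 3 * X (Sum.inr 1) ^ 3 +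
      C (-27) * X (Sum.inl 1) ^ 6 * X (Sum.inr 1) ^ 3)

theorem isWeightedHomogeneous_deltoidEqn :
    IsWeightedHomogeneous (weight 2) deltoidEqn (0, 3) := by
  have hC (z : ℂ) : IsWeightedHomogeneous (weight 2) (C z : CoxRing) 0 :=
    isWeightedHomogeneous_C _ z
  have hX (v : Var) : IsWeightedHomogeneous (weight 2) (X v : CoxRing) (weight 2 v) :=
    isWeightedHomogeneous_X _ _ v
  have e {p : CoxRing} {d : ℤ × ℤ} (h : IsWeightedHomogeneous (weight 2) p d)
      (hd : d = (0, 3)) : IsWeightedHomogeneous (weight 2) p (0, 3) := hd ▸ h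
  refine (((e ((hC _).mul ((hX _).pow 3)) ?_).add
    (e ((((hX _).pow 2).mul ((hX _).pow 2)).mul (hX _)) ?_)).add
    (e (((((hC _).mul (hX _)).mul ((hX _).pow 3)).mul (hX _)).mul ((hX _).pow 2)) ?_)).add
    ((e ((((hC _).mul ((hX _).pow 3)).mul ((hX _).pow 3)).mul ((hX _).pow 3)) ?_).add
    (e (((hC _).mul ((hX _).pow 6)).mul ((hX _).pow 3)) ?_)) <;>
  simp [weight]

/-- The variable `y₀` is singled out as `none`. -/
def varEquiv : Var ≃ Option (Fin 3) where
  toFun := Sum.elim ![some 0, some 1] ![none, some 2]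
  invFun o := o.elim (Sum.inr 0) ![Sum.inl 0, Sum.inl 1, Sum.inr 1]
  left_inv := by decide
  right_inv := by decide

/-- The coordinate ring as a polynomial ring in `y₀` over `ℂ[x₀, x₁, y₁]`. -/
noncomputable def coxEquiv : CoxRing ≃ₐ[ℂ] Polynomial (MvPolynomial (Fin 3) ℂ) :=
  (renameEquiv ℂ varEquiv).trans (optionEquivLeft ℂ (Fin 3))

theorem irreducible_deltoidEqn : Irreducible deltoidEqn := by
  rw [← MulEquiv.irreducible_iff coxEquiv]
  let Q : Polynomial (MvPolynomial (Fin 3) ℂ) := Polynomial.X ^ 3 +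
    (Polynomial.C (C (-1 / 4) * X 0 ^ 2 * X 2) * Polynomial.X ^ 2 +
      Polynomial.C (C (-18 / 4) * X 0 * X 1 ^ 3 * X 2 ^ 2) * Polynomial.X +
      Polynomial.C (X 0 ^ 3 * X 1 ^ 3 * X 2 ^ 3 + C (27 / 4) * X 1 ^ 6 * X 2 ^ 3))
  have hQ : coxEquiv deltoidEqn = Polynomial.C (C (-4)) * Q := by
    have hC (z : ℂ) : coxEquiv (C z) = Polynomial.C (C z) := by
      rw [← algebraMap_eq, AlgEquiv.commutes]; rfl
    have hx0 : coxEquiv (X (Sum.inl 0)) = Polynomial.C (X 0) := by simp [coxEquiv, varEquiv]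
    have hx1 : coxEquiv (X (Sum.inl 1)) = Polynomial.C (X 1) := by simp [coxEquiv, varEquiv]
    have hy0 : coxEquiv (X (Sum.inr 0)) = Polynomial.X := by simp [coxEquiv, varEquiv]
    have hy1 : coxEquiv (X (Sum.inr 1)) = Polynomial.C (X 2) := by simp [coxEquiv, varEquiv]
    have h1 : (C (-4) : MvPolynomial (Fin 3) ℂ) * C (-1 / 4) = 1 := by
      rw [← C_mul, ← C_1]; norm_num
    have h2 : (C (-4) : MvPolynomial (Fin 3) ℂ) * C (-18 / 4) = C 18 := by
      rw [← C_mul]; norm_num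
    have h3 : (C (-4) : MvPolynomial (Fin 3) ℂ) * C (27 / 4) = C (-27) := by
      rw [← C_mul]; norm_num
    simp only [deltoidEqn, Q, map_add, map_mul, map_pow, hC, hx0, hx1, hy0, hy1]
    have h1' := congrArg Polynomial.C h1
    have h2' := congrArg Polynomial.C h2
    have h3' := congrArg Polynomial.C h3
    rw [Polynomial.C_mul] at h1' h2' h3'
    rw [Polynomial.C_1] at h1'
    linear_combination -Polynomial.C (X 0) ^ 2 * Polynomial.X ^ 2 * Polynomial.C (X 2) * h1' -
      Polynomial.C (X 0) * Polynomial.C (X 1) ^ 3 * Polynomial.X * Polynomial.C (X 2) ^ 2 * h2' -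
      Polynomial.C (X 1) ^ 6 * Polynomial.C (X 2) ^ 3 * h3'
  have hu : IsUnit (Polynomial.C (C (-4)) : Polynomial (MvPolynomial (Fin 3) ℂ)) :=
    (((isUnit_iff_ne_zero.2 (by norm_num : (-4 : ℂ) ≠ 0)).map C).map Polynomial.C)
  rw [hQ, irreducible_isUnit_mul hu]
  have hlow : (Polynomial.C (C (-1 / 4) * X 0 ^ 2 * X 2) * Polynomial.X ^ 2 +
      Polynomial.C (C (-18 / 4) * X 0 * X 1 ^ 3 * X 2 ^ 2) * Polynomial.X +
      Polynomial.C (X 0 ^ 3 * X 1 ^ 3 * X 2 ^ 3 + C (27 / 4) * X 1 ^ 6 * X 2 ^ 3) :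
      Polynomial (MvPolynomial (Fin 3) ℂ)).degree < (3 : ℕ) :=
    lt_of_le_of_lt Polynomial.degree_quadratic_le (by norm_num)
  have hmonic : Q.Monic := Polynomial.monic_X_pow_add hlow
  have hdeg : Q.natDegree = 3 := by
    have : Q.degree = (3 : ℕ) := by
      rw [Polynomial.degree_add_eq_left_of_degree_lt, Polynomial.degree_X_pow]
      rwa [Polynomial.degree_X_pow]
    exact Polynomial.natDegree_eq_of_degree_eq_some this
  rw [hmonic.irreducible_iff_roots_eq_zero_of_degree_le_three (by omega) (by omega)]
  refine Multiset.eq_zero_of_forall_notMem fun ρ hρ => ?_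
  have h := Polynomial.isRoot_of_mem_roots hρ
  -- Specialize to `x₁ = y₁ = 1`.
  have h' := congrArg (aeval ![(Polynomial.X : Polynomial ℂ), 1, 1]) h
  simp only [Q, Polynomial.eval_add, Polynomial.eval_mul,
    Polynomial.eval_pow, Polynomial.eval_X, Polynomial.eval_C, map_add, map_mul, map_pow,
    aeval_X, aeval_C, map_zero, Matrix.cons_val_zero, Matrix.cons_val_one, Matrix.cons_val,
    one_pow, mul_one, Polynomial.algebraMap_eq] at h'
  apply deltoid_no_polynomial_root (aeval ![(Polynomial.X : Polynomial ℂ), 1, 1] ρ)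
  have h1 : (4 : Polynomial ℂ) * Polynomial.C (-1 / 4) = -1 := by
    rw [← map_ofNat Polynomial.C, ← Polynomial.C_mul]; norm_num
  have h2 : (4 : Polynomial ℂ) * Polynomial.C (-18 / 4) = -18 := by
    rw [← map_ofNat Polynomial.C, ← map_ofNat Polynomial.C, ← Polynomial.C_mul, ← map_neg]
    norm_num
  have h3 : (4 : Polynomial ℂ) * Polynomial.C (27 / 4) = 27 := by
    rw [← map_ofNat Polynomial.C, ← map_ofNat Polynomial.C, ← Polynomial.C_mul]
    norm_num
  generalize aeval ![(Polynomial.X : Polynomial ℂ), 1, 1] ρ = r at h'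
  linear_combination -4 * h' + Polynomial.X ^ 2 * r ^ 2 * h1 + Polynomial.X * r * h2 + h3

/-- The curve on `𝔽₂` that is the closure of the deltoid. -/
noncomputable def deltoid : Curve 2 0 3 := ⟨deltoidEqn, irreducible_deltoidEqn, isWeightedHomogeneous_deltoidEqn⟩

end Hirzebruch

/-! ### The function field of the deltoid -/

namespace Hirzebruch
open MvPolynomial

/-- A weighted homogeneous polynomial is an eigenvector for the torus action on coordinates. -/
theorem aeval_torus_smul {K : Type} [Field K] [Algebra ℂ K] {e : ℕ} {G : CoxRing} {a b : ℤ}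
    (hG : IsWeightedHomogeneous (weight e) G (a, b)) {σ τ : K} (hσ : σ ≠ 0) (hτ : τ ≠ 0)
    (z : Var → K) :
    aeval (fun v => σ ^ (weight e v).1 * τ ^ (weight e v).2 * z v) G =
      σ ^ a * τ ^ b * aeval z G := by
  rw [aeval_def, aeval_def, eval₂_eq', eval₂_eq', Finset.mul_sum]
  refine Finset.sum_congr rfl fun d hd => ?_
  have hw := hG (mem_support_iff.1 hd)
  rw [Finsupp.weight_apply, Finsupp.sum_fintype _ _ (by simp)] at hw
  have ha : ∑ v, (d v : ℤ) * (weight e v).1 = a := by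
    simpa [Prod.fst_sum] using congrArg Prod.fst hw
  have hb : ∑ v, (d v : ℤ) * (weight e v).2 = b := by
    simpa [Prod.snd_sum] using congrArg Prod.snd hw
  have hprod {ρ : K} (hρ : ρ ≠ 0) (w : Var → ℤ) :
      ∏ v, (ρ ^ w v) ^ d v = ρ ^ ∑ v, (d v : ℤ) * w v := by
    simp only [Fintype.prod_sum_type, Fintype.sum_sum_type, Fin.prod_univ_two, Fin.sum_univ_two,
      zpow_add₀ hρ, mul_comm (d _ : ℤ), zpow_mul, zpow_natCast]
  simp only [mul_pow, Finset.prod_mul_distrib]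
  rw [hprod hσ, hprod hτ, ha, hb]
  ring

theorem Curve.toFrac_eq_zero_iff {e : ℕ} {a b : ℤ} (C : Curve e a b) (G : CoxRing) :
    C.toFrac G = 0 ↔ C.eqn ∣ G := by
  rw [← Ideal.mem_span_singleton, ← Ideal.Quotient.eq_zero_iff_mem]
  exact map_eq_zero_iff (algebraMap C.CoordRing (FractionRing C.CoordRing))
    (IsFractionRing.injective _ _)

theorem Curve.toFrac_ne_zero {e : ℕ} {a b : ℤ} (C : Curve e a b) {G : CoxRing} (z : Var → ℂ)
    (hz : eval z C.eqn = 0) (hG : eval z G ≠ 0) : C.toFrac G ≠ 0 := by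
  rw [Ne, C.toFrac_eq_zero_iff]
  rintro ⟨H, rfl⟩
  simp [hz] at hG

/-- The relations that express the coordinates `X`, `Y` of a point of the deltoid through the
double root `s` of `z ^ 3 - Y * z ^ 2 + X * z - 1`. -/
theorem deltoid_parametrization {K : Type} [Field K] [CharZero K] {x y s : K}
    (hD : y ^ 2 - 3 * x ≠ 0) (hs : s = (x * y - 9) / (2 * (y ^ 2 - 3 * x)))
    (h : -4 * y ^ 3 + x ^ 2 * y ^ 2 + 18 * x * y - 4 * x ^ 3 - 27 = 0) :
    s ≠ 0 ∧ y = 2 * s + 1 / s ^ 2 ∧ x = s ^ 2 + 2 / s := by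
  have hs' : 2 * (y ^ 2 - 3 * x) * s = x * y - 9 := by
    rw [hs]; field_simp
  have h4 : (4 : K) * (y ^ 2 - 3 * x) ^ 2 ≠ 0 := by
    have : (4 : K) ≠ 0 := by norm_num
    exact mul_ne_zero this (pow_ne_zero 2 hD)
  set D := y ^ 2 - 3 * x with hDdef
  have E1 : 3 * s ^ 2 - 2 * y * s + x = 0 := by
    refine (mul_eq_zero.1 (?_ : 4 * D ^ 2 * _ = 0)).resolve_left h4
    linear_combination (3 * (2 * D * s + (x * y - 9)) - 4 * y * D) * hs' - 9 * h
  have E2 : y * s ^ 2 - 2 * x * s + 3 = 0 := by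
    refine (mul_eq_zero.1 (?_ : 4 * D ^ 2 * _ = 0)).resolve_left h4
    linear_combination (y * (2 * D * s + (x * y - 9)) - 4 * x * D) * hs' - 3 * y * h
  have hs0 : s ≠ 0 := by
    rintro rfl
    norm_num at E2
  have E3 : y * s ^ 2 = 2 * s ^ 3 + 1 := by
    linear_combination (-1 / 3 : K) * E2 - (2 / 3 : K) * s * E1
  have hy : y = 2 * s + 1 / s ^ 2 := by
    field_simp
    linear_combination E3
  refine ⟨hs0, hy, ?_⟩
  have : x = 2 * y * s - 3 * s ^ 2 := by linear_combination E1
  rw [this, hy]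
  field_simp
  ring

theorem exists_algebraMap_eq_of_not_transcendental {K : Type} [Field K] [Algebra ℂ K] {s : K}
    (hs : ¬ Transcendental ℂ s) : ∃ c : ℂ, algebraMap ℂ K c = s := by
  have h : IsIntegral ℂ s := (not_not.1 hs).isIntegral
  exact minpoly.mem_range_of_degree_eq_one ℂ s
    (IsAlgClosed.degree_eq_one_of_irreducible ℂ (minpoly.irreducible h))

theorem eval_deltoidEqn (z : Var → ℂ) : eval z deltoidEqn =
    -4 * z (Sum.inr 0) ^ 3 + z (Sum.inl 0) ^ 2 * z (Sum.inr 0) ^ 2 * z (Sum.inr 1) +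
    18 * z (Sum.inl 0) * z (Sum.inl 1) ^ 3 * z (Sum.inr 0) * z (Sum.inr 1) ^ 2 +
    (-4 * z (Sum.inl 0) ^ 3 * z (Sum.inl 1) ^ 3 * z (Sum.inr 1) ^ 3 +
      -27 * z (Sum.inl 1) ^ 6 * z (Sum.inr 1) ^ 3) := by
  simp [deltoidEqn]

theorem deltoid_dehomogenize {K : Type} [Field K] {a b c d : K} (hb : b ≠ 0) (hd : d ≠ 0)
    (h : -4 * c ^ 3 + a ^ 2 * c ^ 2 * d + 18 * a * b ^ 3 * c * d ^ 2 +
      (-4 * a ^ 3 * b ^ 3 * d ^ 3 + -27 * b ^ 6 * d ^ 3) = 0) :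
    -4 * (c / (b ^ 2 * d)) ^ 3 + (a / b) ^ 2 * (c / (b ^ 2 * d)) ^ 2 +
      18 * (a / b) * (c / (b ^ 2 * d)) - 4 * (a / b) ^ 3 - 27 = 0 := by
  field_simp
  linear_combination h

theorem eq_zero_of_dehomogenize {K : Type} [Field K] {a b c d : K} (hb : b ≠ 0) (hd : d ≠ 0)
    (h : (c / (b ^ 2 * d)) ^ 2 - 3 * (a / b) = 0) : c ^ 2 - 3 * a * b ^ 3 * d ^ 2 = 0 := by
  field_simp at h
  linear_combination h

/-- Every point with `x₁ ≠ 0` and `y₁ ≠ 0` is a torus translate of `(x₀/x₁, 1, y₀/(x₁²y₁), 1)`. -/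
theorem torus_smul_dehomogenize {K : Type} [Field K] (z : Var → K) (hb : z (Sum.inl 1) ≠ 0)
    (hd : z (Sum.inr 1) ≠ 0) (v : Var) :
    z (Sum.inl 1) ^ (weight 2 v).1 * (z (Sum.inl 1) ^ 2 * z (Sum.inr 1)) ^ (weight 2 v).2 *
      (Sum.elim ![z (Sum.inl 0) / z (Sum.inl 1), 1]
        ![z (Sum.inr 0) / (z (Sum.inl 1) ^ 2 * z (Sum.inr 1)), 1] v : K) = z v := by
  rcases v with v | v <;> fin_cases v
  · simp [weight]
    field_simp
  · simp [weight]
  · simp [weight]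
    field_simp
  · simp [weight, zpow_neg]
    field_simp

theorem isRational_deltoid : deltoid.IsRational := by
  let φ := deltoid.toFrac
  have hX (v : Var) : IsWeightedHomogeneous (weight 2) (X v : CoxRing) (weight 2 v) :=
    isWeightedHomogeneous_X _ _ v
  -- Nonvanishing on the curve is tested at the cusp `X = Y = 3`, at the smooth point
  -- `X = Y = -1`, and at the cusp at infinity.
  have hx1 : φ (X (Sum.inl 1)) ≠ 0 :=
    deltoid.toFrac_ne_zero (Sum.elim ![3, 1] ![3, 1])
      (by change eval _ deltoidEqn = 0; rw [eval_deltoidEqn]; norm_num) (by simp)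
  have hy1 : φ (X (Sum.inr 1)) ≠ 0 :=
    deltoid.toFrac_ne_zero (Sum.elim ![3, 1] ![3, 1])
      (by change eval _ deltoidEqn = 0; rw [eval_deltoidEqn]; norm_num) (by simp)
  have hD : φ (X (Sum.inr 0) ^ 2 -
      C 3 * X (Sum.inl 0) * X (Sum.inl 1) ^ 3 * X (Sum.inr 1) ^ 2) ≠ 0 :=
    deltoid.toFrac_ne_zero (Sum.elim ![-1, 1] ![-1, 1])
      (by change eval _ deltoidEqn = 0; rw [eval_deltoidEqn]; norm_num) (by simp; norm_num)
  have hconst (c : ℂ) : φ (X (Sum.inl 0) - C c * X (Sum.inl 1)) ≠ 0 :=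
    deltoid.toFrac_ne_zero (Sum.elim ![1, 0] ![0, 1])
      (by change eval _ deltoidEqn = 0; rw [eval_deltoidEqn]; norm_num) (by simp)
  let x : deltoid.functionField := ⟨φ (X (Sum.inl 0)) / φ (X (Sum.inl 1)), (1, 0),
    X (Sum.inl 0), X (Sum.inl 1), hX _, hX _, hx1, rfl⟩
  let y : deltoid.functionField :=
    ⟨φ (X (Sum.inr 0)) / φ (X (Sum.inl 1) ^ 2 * X (Sum.inr 1)), (0, 1),
      X (Sum.inr 0), X (Sum.inl 1) ^ 2 * X (Sum.inr 1), hX _, by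
        simpa [weight] using ((hX (Sum.inl 1)).pow 2).mul (hX (Sum.inr 1)), by
        rw [map_mul, map_pow]; exact mul_ne_zero (pow_ne_zero 2 hx1) hy1, rfl⟩
  have hxv : (x : FractionRing deltoid.CoordRing) = φ (X (Sum.inl 0)) / φ (X (Sum.inl 1)) := rfl
  have hyv : (y : FractionRing deltoid.CoordRing) =
      φ (X (Sum.inr 0)) / (φ (X (Sum.inl 1)) ^ 2 * φ (X (Sum.inr 1))) := by
    rw [← map_pow, ← map_mul]
  have hC (c : ℂ) : φ (C c) = algebraMap ℂ _ c := φ.commutes c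
  have hyx : y ^ 2 - 3 * x ≠ 0 := by
    intro h
    apply hD
    have h' : (y : FractionRing deltoid.CoordRing) ^ 2 - 3 * x = 0 := congrArg Subtype.val h
    rw [hxv, hyv] at h'
    rw [map_sub, map_mul, map_mul, map_mul, map_pow, map_pow, map_pow, hC, map_ofNat]
    exact eq_zero_of_dehomogenize hx1 hy1 h'
  have hF : -4 * y ^ 3 + x ^ 2 * y ^ 2 + 18 * x * y - 4 * x ^ 3 - 27 = 0 := by
    have h0 : φ deltoidEqn = 0 := (deltoid.toFrac_eq_zero_iff _).2 dvd_rfl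
    simp only [deltoidEqn, map_add, map_mul, map_pow, map_neg, map_ofNat] at h0
    apply Subtype.ext
    change -4 * (y : FractionRing deltoid.CoordRing) ^ 3 + (x : FractionRing deltoid.CoordRing) ^ 2 *
      (y : FractionRing deltoid.CoordRing) ^ 2 + 18 * (x : FractionRing deltoid.CoordRing) *
      (y : FractionRing deltoid.CoordRing) - 4 * (x : FractionRing deltoid.CoordRing) ^ 3 - 27 = 0
    rw [hxv, hyv]
    exact deltoid_dehomogenize hx1 hy1 h0
  let s : deltoid.functionField := (x * y - 9) / (2 * (y ^ 2 - 3 * x))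
  obtain ⟨hs0, hys, hxs⟩ := deltoid_parametrization hyx (s := s) rfl hF
  have htr : Transcendental ℂ s := by
    by_contra hs
    obtain ⟨c, hc⟩ := exists_algebraMap_eq_of_not_transcendental hs
    apply hconst (c ^ 2 + 2 / c)
    have hx : x = algebraMap ℂ _ (c ^ 2 + 2 / c) := by
      rw [hxs, ← hc, map_add, map_pow, map_div₀, map_ofNat (algebraMap ℂ _)]
    have hx' : (x : FractionRing deltoid.CoordRing) = algebraMap ℂ _ (c ^ 2 + 2 / c) :=
      congrArg Subtype.val hx
    rw [map_sub, map_mul, hC, ← hx', hxv, div_mul_cancel₀ _ hx1, sub_self]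
  refine geometricGenus_eq_zero s htr fun q => ?_
  suffices hq : q ∈ IntermediateField.adjoin ℂ {s} by
    obtain ⟨p, r, h⟩ := IntermediateField.mem_adjoin_simple_iff ℂ q |>.1 hq
    by_cases hr : r = 0
    · exact ⟨0, 1, one_ne_zero, by rw [h, hr]; simp⟩
    · exact ⟨p, r, hr, h⟩
  have hsmem : s ∈ IntermediateField.adjoin ℂ {s} := IntermediateField.mem_adjoin_simple_self ℂ s
  have hxmem : x ∈ IntermediateField.adjoin ℂ {s} := by
    rw [hxs]
    exact add_mem (pow_mem hsmem 2) (div_mem (ofNat_mem _ 2) hsmem)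
  have hymem : y ∈ IntermediateField.adjoin ℂ {s} := by
    rw [hys]
    exact add_mem (mul_mem (ofNat_mem _ 2) hsmem) (div_mem (one_mem _) (pow_mem hsmem 2))
  let z : Var → deltoid.functionField := Sum.elim ![x, 1] ![y, 1]
  have hz (G : CoxRing) : aeval z G ∈ IntermediateField.adjoin ℂ {s} := by
    induction G using MvPolynomial.induction_on with
    | C a => rw [aeval_C]; exact IntermediateField.algebraMap_mem _ a
    | add p q hp hq => rw [map_add]; exact add_mem hp hq
    | mul_X p v hp =>
      rw [map_mul, aeval_X]
      refine mul_mem hp ?_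
      rcases v with v | v <;> fin_cases v
      exacts [hxmem, one_mem _, hymem, one_mem _]
  have hG {G : CoxRing} {a b : ℤ} (hG : IsWeightedHomogeneous (weight 2) G (a, b)) :
      φ G = φ (X (Sum.inl 1)) ^ a * (φ (X (Sum.inl 1)) ^ 2 * φ (X (Sum.inr 1))) ^ b *
        (aeval z G : deltoid.functionField) := by
    have hval : ((aeval z G : deltoid.functionField) : FractionRing deltoid.CoordRing) =
        aeval (fun v => (z v : FractionRing deltoid.CoordRing)) G := by
      change deltoid.functionField.val (aeval z G) = _
      rw [MvPolynomial.comp_aeval_apply]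
      rfl
    rw [hval, ← aeval_torus_smul hG hx1 (mul_ne_zero (pow_ne_zero 2 hx1) hy1)]
    conv_lhs => rw [← aeval_X_left_apply G, MvPolynomial.comp_aeval_apply]
    congr 2
    funext v
    rw [← torus_smul_dehomogenize (fun v => φ (X v)) hx1 hy1 v]
    congr 1
    rcases v with v | v <;> fin_cases v
    exacts [hxv.symm, rfl, hyv.symm, rfl]
  obtain ⟨_, ⟨a, b⟩, G, H, hGw, hHw, hH, rfl⟩ := q
  have : (⟨deltoid.toFrac G / deltoid.toFrac H, (a, b), G, H, hGw, hHw, hH, rfl⟩ :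
      deltoid.functionField) = aeval z G / aeval z H := by
    apply Subtype.ext
    change φ G / φ H = ((aeval z G : deltoid.functionField) : FractionRing deltoid.CoordRing) /
      (aeval z H : deltoid.functionField)
    rw [hG hGw, hG hHw, mul_div_mul_left]
    exact mul_ne_zero (zpow_ne_zero _ hx1) (zpow_ne_zero _ (mul_ne_zero (pow_ne_zero 2 hx1) hy1))
  rw [this]
  exact div_mem (hz G) (hz H)

end Hirzebruch

/-! ### The singular points of the deltoid -/

namespace Hirzebruch
open MvPolynomial

/-- The affine cusp `X = 3 ζ², Y = 3 ζ` of the deltoid, for a cube root of unity `ζ`. -/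
noncomputable def finiteCusp (ζ : ℂ) : Surface 2 := chartPoint 2 1 1 (3 * ζ ^ 2) (3 * ζ)

/-- The cusp of the deltoid on the fibre `x₁ = 0`. -/
noncomputable def cuspAtInfinity : Surface 2 := chartPoint 2 0 1 0 0

theorem chartPoint_eq_iff (e : ℕ) (i j i' j' : Fin 2) (r s r' s' : ℂ) :
    chartPoint e i j r s = chartPoint e i' j' r' s' ↔ ∃ σ τ : ℂˣ, ∀ v : Var,
      (chartCoords i' j' r' s').1 v =
        ((σ ^ (weight e v).1 * τ ^ (weight e v).2 : ℂˣ) : ℂ) * (chartCoords i j r s).1 v :=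
  Quotient.eq (r := coordsSetoid e)

theorem finiteCusp_injective : Function.Injective finiteCusp := by
  intro ζ ζ' h
  obtain ⟨σ, τ, h⟩ := (chartPoint_eq_iff ..).1 h
  have h1 := h (Sum.inl 1)
  have h2 := h (Sum.inr 1)
  have h3 := h (Sum.inr 0)
  simp [chartCoords, weight] at h1 h2 h3
  rw [← h1] at h2
  simp at h2
  rw [← h2] at h3
  simpa [eq_comm] using h3

theorem finiteCusp_ne_cuspAtInfinity (ζ : ℂ) : finiteCusp ζ ≠ cuspAtInfinity := by
  intro h
  obtain ⟨σ, τ, h⟩ := (chartPoint_eq_iff ..).1 h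
  have h1 := h (Sum.inl 1)
  simp [chartCoords, weight] at h1
  exact σ.ne_zero h1.symm

theorem coeff_biexp_one_zero (f : Poly₂) :
    coeff (biexp 1 0) f = constantCoeff (pderiv 0 f) := by
  have := coeff_pderiv f (i := 0) 0
  simpa [biexp, ← constantCoeff_eq] using this.symm

theorem coeff_biexp_zero_one (f : Poly₂) :
    coeff (biexp 0 1) f = constantCoeff (pderiv 1 f) := by
  have := coeff_pderiv f (i := 1) 0
  simpa [biexp, ← constantCoeff_eq] using this.symm

theorem eq_zero_of_two_le_mult {f : Poly₂} (hf : 2 ≤ mult f) :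
    constantCoeff f = 0 ∧ constantCoeff (pderiv 0 f) = 0 ∧ constantCoeff (pderiv 1 f) = 0 := by
  rw [← coeff_biexp_zero_zero, ← coeff_biexp_one_zero, ← coeff_biexp_zero_one]
  exact ⟨coeff_eq_zero_of_lt_mult (by omega), coeff_eq_zero_of_lt_mult (by omega),
    coeff_eq_zero_of_lt_mult (by omega)⟩

/-- The singular points of the affine deltoid: its equation and the two partial derivatives combine
to `(r s - 9)² = 0`. -/
theorem eq_finiteCusp {r s : ℂ} (h : r ^ 2 * s ^ 2 + 18 * r * s - 4 * r ^ 3 - 4 * s ^ 3 - 27 = 0)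
    (hr : 2 * r * s ^ 2 + 18 * s - 12 * r ^ 2 = 0) (hs : 2 * r ^ 2 * s + 18 * r - 12 * s ^ 2 = 0) :
    ∃ ζ : ℂ, ζ ^ 3 = 1 ∧ r = 3 * ζ ^ 2 ∧ s = 3 * ζ := by
  have h9 : r * s - 9 = 0 := pow_eq_zero_iff two_ne_zero |>.1 (by
    linear_combination -3 * h + r * hr + s * hs)
  have h27 : s ^ 3 = 27 := by
    linear_combination (-s / 12) * hs + (r * s / 6 + 3) * h9
  have hs0 : s ≠ 0 := by rintro rfl; norm_num at h27
  refine ⟨s / 3, by linear_combination h27 / 27, ?_, by ring⟩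
  apply mul_right_cancel₀ hs0
  linear_combination h9 - h27 / 3

theorem localEqn_one_one (r s : ℂ) : deltoid.localEqn 1 1 r s =
    C (-4) * (X 1 + C s) ^ 3 + (X 0 + C r) ^ 2 * (X 1 + C s) ^ 2 +
      C 18 * (X 0 + C r) * (X 1 + C s) + (C (-4) * (X 0 + C r) ^ 3 + C (-27)) := by
  simp only [Curve.localEqn, deltoid, deltoidEqn]
  simp

theorem localEqn_one_zero (r s : ℂ) : deltoid.localEqn 1 0 r s =
    C (-4) + (X 0 + C r) ^ 2 * (X 1 + C s) +
      C 18 * (X 0 + C r) * (X 1 + C s) ^ 2 + (C (-4) * (X 0 + C r) ^ 3 * (X 1 + C s) ^ 3 +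
        C (-27) * (X 1 + C s) ^ 3) := by
  simp only [Curve.localEqn, deltoid, deltoidEqn]
  simp

theorem localEqn_zero_one (r s : ℂ) : deltoid.localEqn 0 1 r s =
    C (-4) * (X 1 + C s) ^ 3 + (X 1 + C s) ^ 2 +
      C 18 * (X 0 + C r) ^ 3 * (X 1 + C s) +
      (C (-4) * (X 0 + C r) ^ 3 + C (-27) * (X 0 + C r) ^ 6) := by
  simp only [Curve.localEqn, deltoid, deltoidEqn]
  simp

theorem localEqn_zero_zero (r s : ℂ) : deltoid.localEqn 0 0 r s =
    C (-4) + (X 1 + C s) +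
      C 18 * (X 0 + C r) ^ 3 * (X 1 + C s) ^ 2 + (C (-4) * (X 0 + C r) ^ 3 * (X 1 + C s) ^ 3 +
        C (-27) * (X 0 + C r) ^ 6 * (X 1 + C s) ^ 3) := by
  simp only [Curve.localEqn, deltoid, deltoidEqn]
  simp

/-- The singular points of the deltoid: in all four charts, Euler's relations reduce the equations
to those in the chart `x₁ = y₁ = 1`, except for the point at infinity. -/
theorem eq_cusp_of_isSingular {p : Surface 2} (hp : deltoid.IsSingular p) :
    (∃ ζ : ℂ, ζ ^ 3 = 1 ∧ p = finiteCusp ζ) ∨ p = cuspAtInfinity := by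
  have main (r s : ℂ) (hp : p = chartPoint 2 1 1 r s)
      (h : r ^ 2 * s ^ 2 + 18 * r * s - 4 * r ^ 3 - 4 * s ^ 3 - 27 = 0)
      (hr : 2 * r * s ^ 2 + 18 * s - 12 * r ^ 2 = 0)
      (hs : 2 * r ^ 2 * s + 18 * r - 12 * s ^ 2 = 0) :
      (∃ ζ : ℂ, ζ ^ 3 = 1 ∧ p = finiteCusp ζ) ∨ p = cuspAtInfinity := by
    obtain ⟨ζ, h1, rfl, rfl⟩ := eq_finiteCusp h hr hs
    exact Or.inl ⟨ζ, h1, hp⟩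
  obtain ⟨-, f, ⟨i, j, r, s, hp, rfl⟩, hf⟩ := hp
  obtain ⟨h, hr, hs⟩ := eq_zero_of_two_le_mult hf
  fin_cases i <;> fin_cases j <;> simp only [Fin.zero_eta, Fin.mk_one] at hp h hr hs
  · rw [localEqn_zero_zero] at h hr hs
    simp [pderiv_X, Derivation.leibniz_pow, map_ofNat constantCoeff] at h hr hs
    have hs0 : s ≠ 0 := by rintro rfl; simp at h
    have hr0 : r ≠ 0 := by
      rintro rfl
      simp at hs
    have hr' : 2 + 18 * r ^ 3 * s - 12 * r ^ 3 * s ^ 2 = 0 := by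
      refine (mul_eq_zero.1 (?_ : s * _ = 0)).resolve_left hs0
      linear_combination -r * hr + 2 * s * hs
    have hs' : 2 * s + 18 * r ^ 3 * s ^ 2 - 12 = 0 := by linear_combination 3 * h - s * hs
    refine main r⁻¹ (r ^ 2 * s)⁻¹ ?_ ?_ ?_ ?_
    · rw [← hp, chartPoint_eq_iff]
      refine ⟨(Units.mk0 r hr0)⁻¹, (Units.mk0 (r ^ 2 * s) (mul_ne_zero (pow_ne_zero 2 hr0) hs0))⁻¹,
        fun v => ?_⟩
      rcases v with v | v <;> fin_cases v <;> simp [chartCoords, weight, hr0]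
      field_simp
    · field_simp
      linear_combination h
    · field_simp
      linear_combination hr'
    · field_simp
      linear_combination hs'
  · rw [localEqn_zero_one] at h hr hs
    simp [pderiv_X, Derivation.leibniz_pow, map_ofNat constantCoeff] at h hr hs
    by_cases hr0 : r = 0
    · right
      subst hr0
      have hs0 : s = 0 := pow_eq_zero_iff two_ne_zero |>.1 (by linear_combination 3 * h - s * hs)
      rw [← hp, hs0]
      rfl
    refine main r⁻¹ (s / r ^ 2) ?_ ?_ ?_ ?_
    · rw [← hp, chartPoint_eq_iff]
      refine ⟨(Units.mk0 r hr0)⁻¹, (Units.mk0 (r ^ 2) (pow_ne_zero 2 hr0))⁻¹, fun v => ?_⟩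
      rcases v with v | v <;> fin_cases v <;> simp [chartCoords, weight, hr0]
      field_simp
    · field_simp
      linear_combination h
    · field_simp
      linear_combination 6 * h - r * hr - 2 * s * hs
    · field_simp
      linear_combination hs
  · rw [localEqn_one_zero] at h hr hs
    simp [pderiv_X, Derivation.leibniz_pow, map_ofNat constantCoeff] at h hr hs
    have hs0 : s ≠ 0 := by rintro rfl; simp at h
    have hr' : 2 * r + 18 * s - 12 * r ^ 2 * s ^ 2 = 0 := by
      refine (mul_eq_zero.1 (?_ : s * _ = 0)).resolve_left hs0
      linear_combination hr
    refine main r s⁻¹ ?_ ?_ ?_ ?_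
    · rw [← hp, chartPoint_eq_iff]
      refine ⟨1, (Units.mk0 s hs0)⁻¹, fun v => ?_⟩
      rcases v with v | v <;> fin_cases v <;> simp [chartCoords, weight, hs0]
    · field_simp
      linear_combination h
    · field_simp
      linear_combination hr'
    · field_simp
      linear_combination 3 * h - s * hs
  · rw [localEqn_one_one] at h hr hs
    simp [pderiv_X, Derivation.leibniz_pow, map_ofNat constantCoeff] at h hr hs
    exact main r s hp.symm (by linear_combination h) (by linear_combination hr)
      (by linear_combination hs)

/-! ### The four cusps -/

theorem localEqn_finiteCusp {ζ : ℂ} (hζ : ζ ^ 3 = 1) :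
    deltoid.localEqn 1 1 (3 * ζ ^ 2) (3 * ζ) =
      C (-27 * ζ ^ 2) * (X 0 ^ 2 * X 1 ^ 0) + C 54 * (X 0 ^ 1 * X 1 ^ 1) +
        C (-27 * ζ) * (X 0 ^ 0 * X 1 ^ 2) + C (-4) * (X 0 ^ 3 * X 1 ^ 0) +
        C (6 * ζ) * (X 0 ^ 2 * X 1 ^ 1) + C (6 * ζ ^ 2) * (X 0 ^ 1 * X 1 ^ 2) +
        C (-4) * (X 0 ^ 0 * X 1 ^ 3) + C 1 * (X 0 ^ 2 * X 1 ^ 2) := by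
  have hC : (C ζ : Poly₂) ^ 3 = 1 := by rw [← C_pow, hζ, C_1]
  rw [localEqn_one_one]
  simp only [map_mul, map_pow, map_neg, map_ofNat, map_one]
  linear_combination (-27 * (C ζ ^ 3 - 1) + 54 * C ζ ^ 2 * X 1 - 54 * C ζ * X 0 +
    36 * X 0 * X 1 + 9 * C ζ * X 1 ^ 2) * hC

theorem localEqn_cuspAtInfinity : deltoid.localEqn 0 1 0 0 =
    C 1 * (X 0 ^ 0 * X 1 ^ 2) + C (-4) * (X 0 ^ 3 * X 1 ^ 0) + C (-4) * (X 0 ^ 0 * X 1 ^ 3) +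
      C 18 * (X 0 ^ 3 * X 1 ^ 1) + C (-27) * (X 0 ^ 6 * X 1 ^ 0) := by
  rw [localEqn_zero_one]
  simp only [C_0, C_1, add_zero]
  ring

theorem Curve.constantCoeff_localEqn {e : ℕ} {a b : ℤ} (C : Curve e a b) (i j : Fin 2) (r s : ℂ) :
    constantCoeff (C.localEqn i j r s) = eval (chartCoords i j r s).1 C.eqn := by
  unfold Curve.localEqn
  generalize C.eqn = G
  induction G using MvPolynomial.induction_on with
  | C z => simp
  | add p q hp hq => rw [map_add, map_add, map_add, hp, hq]
  | mul_X p v hp =>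
    rw [map_mul, map_mul, map_mul, hp, aeval_X, eval_X]
    congr 1
    rcases v with v | v <;> simp only [chartCoords, Sum.elim_inl, Sum.elim_inr] <;> split_ifs <;>
      simp

theorem coeff_biexp_C_mul_X_pow (a b i j : ℕ) (z : ℂ) :
    coeff (biexp a b) (C z * (X 0 ^ i * X 1 ^ j) : Poly₂) = if a = i ∧ b = j then z else 0 := by
  have : C z * (X 0 ^ i * X 1 ^ j) = monomial (biexp i j) z := by
    rw [biexp, monomial_eq, Finsupp.prod_add_index' (by simp) (by simp [pow_add])]
    simp
  rw [this, coeff_monomial]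
  simp only [biexp_inj, eq_comm]

/-- A point is an ordinary cusp with multiplicity sequence `[2, 1, 1]` if in some chart the quadratic
part of the local equation is `k (α u + β v)²`, the cubic part is not divisible by `α u + β v`, and
the strict transform at the point `c` of the exceptional line is `A v² + u B` with `B(0) ≠ 0`. -/
theorem isCusp_and_hasMultSeqAt {p : Surface 2} {i j : Fin 2} {r s c A k α β : ℂ} {f B : Poly₂}
    (hp : chartPoint 2 i j r s = p) (hf : deltoid.localEqn i j r s = f)
    (hA : A ≠ 0) (hB : constantCoeff B ≠ 0)
    (hbl : blowup (some c) f = X 0 ^ 2 * (C A * X 1 ^ 2 + X 0 * B))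
    (h00 : coeff (biexp 0 0) f = 0) (h10 : coeff (biexp 1 0) f = 0)
    (h01 : coeff (biexp 0 1) f = 0) (hk : k ≠ 0) (hβ : β ≠ 0)
    (h20 : coeff (biexp 2 0) f = k * α ^ 2) (h11 : coeff (biexp 1 1) f = 2 * k * α * β)
    (h02 : coeff (biexp 0 2) f = k * β ^ 2)
    (h3 : coeff (biexp 3 0) f * β ^ 3 - coeff (biexp 2 1) f * β ^ 2 * α +
      coeff (biexp 1 2) f * β * α ^ 2 - coeff (biexp 0 3) f * α ^ 3 ≠ 0) :
    deltoid.IsCusp p ∧ deltoid.HasMultSeqAt p [2, 1, 1] := by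
  have hm : mult f = 2 := by
    refine mult_eq (i := 0) (j := 2) ?_ rfl ?_
    · intro i j hij
      have hi : i < 2 := by omega
      have hj : j < 2 := by omega
      interval_cases i <;> interval_cases j <;> first | assumption | omega
    · rw [h02]
      exact mul_ne_zero hk (pow_ne_zero 2 hβ)
  have hloc : deltoid.IsLocalEqn p f := ⟨i, j, r, s, hp, hf⟩
  refine ⟨⟨⟨⟨chartCoords i j r s, hp, ?_⟩, f, hloc, hm.ge⟩, f, hloc,
    germIrreducible_of_quadratic_cubic hk (Or.inr hβ) h00 h20 h11 h02 h3⟩, f, hloc,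
    hasMultSeq_of_blowup hA hB hm hbl⟩
  rw [← Curve.constantCoeff_localEqn, hf, ← coeff_biexp_zero_zero, h00]

theorem isCusp_finiteCusp {ζ : ℂ} (hζ : ζ ^ 3 = 1) :
    deltoid.IsCusp (finiteCusp ζ) ∧ deltoid.HasMultSeqAt (finiteCusp ζ) [2, 1, 1] := by
  have hζ0 : ζ ≠ 0 := by rintro rfl; simp at hζ
  have hC : (C ζ : Poly₂) ^ 3 = 1 := by rw [← C_pow, hζ, C_1]
  refine isCusp_and_hasMultSeqAt (c := ζ ^ 2) (A := -27 * ζ)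
    (B := C 4 + C (6 * ζ) * X 1 + C (-6 * ζ ^ 2) * X 1 ^ 2 + C (-4) * X 1 ^ 3 +
      X 0 * (X 1 + C (ζ ^ 2)) ^ 2) (k := -27 * ζ ^ 2) (α := 1) (β := -ζ) rfl
    (localEqn_finiteCusp hζ) ?_ ?_ ?_ ?_ ?_ ?_ (by simpa using hζ0) (neg_ne_zero.2 hζ0) ?_ ?_ ?_ ?_
  · simpa using hζ0
  · simp
  · simp only [blowup, map_add, map_mul, map_pow, aeval_X, aeval_C, algebraMap_eq, map_neg,
      map_ofNat, map_one, Matrix.cons_val_zero, Matrix.cons_val_one]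
    linear_combination X 0 ^ 2 * (-27 * C ζ ^ 2 - 54 * X 1 + X 0 * (2 * C ζ ^ 3 + 8)) * hC
  all_goals simp only [coeff_add, coeff_biexp_C_mul_X_pow]
  all_goals norm_num [hζ0]
  · linear_combination -54 * hζ
  · linear_combination -27 * ζ * hζ
  · intro h
    have : (4 : ℂ) = 0 := by linear_combination -h - 8 * hζ
    norm_num at this

theorem isCusp_cuspAtInfinity :
    deltoid.IsCusp cuspAtInfinity ∧ deltoid.HasMultSeqAt cuspAtInfinity [2, 1, 1] := by
  refine isCusp_and_hasMultSeqAt (c := 0) (A := 1)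
    (B := C (-4) + C (-4) * X 1 ^ 3 + C 18 * (X 0 * X 1) + C (-27) * X 0 ^ 3)
    (k := 1) (α := 0) (β := 1) rfl localEqn_cuspAtInfinity ?_ ?_ ?_ ?_ ?_ ?_ one_ne_zero one_ne_zero
    ?_ ?_ ?_ ?_
  · simp
  · simp
  · simp only [blowup, map_add, map_mul, map_pow, aeval_X, map_neg, map_one,
      map_ofNat, Matrix.cons_val_zero, Matrix.cons_val_one, C_0]
    ring
  all_goals simp only [coeff_add, coeff_biexp_C_mul_X_pow]
  all_goals norm_num

end Hirzebruch

theorem theorem4p7 : ∃ C : Hirzebruch.Curve 2 0 3,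
    C.IsRational ∧ C.IsCuspidal ∧ {p | C.IsCusp p}.ncard = 4 ∧
      C.HasCuspidalConfiguration {[2], [2], [2], [2]} := by
  classical
  open Hirzebruch in
  let S : Finset (Surface 2) :=
    insert cuspAtInfinity ((Polynomial.nthRootsFinset 3 (1 : ℂ)).image finiteCusp)
  have hS (p : Surface 2) : p ∈ S ↔
      (∃ ζ : ℂ, ζ ^ 3 = 1 ∧ p = finiteCusp ζ) ∨ p = cuspAtInfinity := by
    simp only [S, Finset.mem_insert, Finset.mem_image, Polynomial.mem_nthRootsFinset (n := 3)
      (by norm_num) (1 : ℂ), eq_comm (a := p), or_comm]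
  have hScard : S.card = 4 := by
    rw [Finset.card_insert_of_notMem, Finset.card_image_of_injective _ finiteCusp_injective,
      (Complex.isPrimitiveRoot_exp 3 (by norm_num)).card_nthRootsFinset]
    intro h
    obtain ⟨ζ, -, h⟩ := Finset.mem_image.1 h
    exact finiteCusp_ne_cuspAtInfinity ζ h
  have hcusp (p : Surface 2) (hp : p ∈ S) :
      deltoid.IsCusp p ∧ deltoid.HasMultSeqAt p [2, 1, 1] := by
    rcases (hS p).1 hp with ⟨ζ, hζ, rfl⟩ | rfl
    exacts [isCusp_finiteCusp hζ, isCusp_cuspAtInfinity]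
  have hsing (p : Surface 2) (hp : deltoid.IsSingular p) : p ∈ S :=
    (hS p).2 (eq_cusp_of_isSingular hp)
  have hiff (p : Surface 2) : p ∈ S ↔ deltoid.IsCusp p :=
    ⟨fun hp => (hcusp p hp).1, fun hp => hsing p hp.1⟩
  refine ⟨deltoid, isRational_deltoid, fun p hp => (hcusp p (hsing p hp)).1, ?_, S,
    fun _ => [2, 1, 1], hiff, fun p hp => (hcusp p hp).2, ?_⟩
  · have : {p | deltoid.IsCusp p} = (S : Set (Surface 2)) := by
      ext p
      exact (hiff p).symm
    rw [this, Set.ncard_coe_finset, hScard]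
  · rw [Multiset.map_const', compact_two_one_one]
    change Multiset.replicate S.card [2] = _
    rw [hScard]
    rfl
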